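/- Let $n,s>0$ and let $M$ be a non-empty smooth (Hausdorff, second countable) manifold of dimension $2n+s$ with a weak metric $f$-structure $(f,Q,\xi_i,\eta^i,g)_{1\le i\le s}$: $f$ is a $(1,1)$-tensor of rank $2n$, $Q$ a non-singular $(1,1)$-tensor, $\xi_i$ are vector fields, $\eta^i$ are $1$-forms and $g$ is a Riemannian metric (all smooth) with $$f^2=-Q+\sum_i\eta^i\otimes\xi_i,\quad \eta^i(\xi_j)=\delta^i_j,\quad Q\xi_i=\xi_i,\quad g(fX,fY)=g(X,QY)-\sum_i\eta^i(X)\eta^i(Y),$$ and such that the distribution $\mathcal D=\bigcap_i\ker\eta^i$ is $f$-invariant. Let $\nabla$ be the Levi-Civita connection of $g$, $R_{X,Y}=\nabla_X\nabla_Y-\nabla_Y\nabla_X-\nabla_{[X,Y]}$, $h_i=\frac12\pounds_{\xi_i}f$, $\widetilde h_i=Q^{-1}h_i$ and $\bar\eta=\sum_i\eta^i$. Assume that $M$ is a weak $f$-$(\kappa,\mu)$-manifold for some $\kappa,\mu\in\mathbb R$, that is, for all $i$ and all vector fields $X,Y$, $$g(X,fY)=d\eta^i(X,Y):=\tfrac12\{X(\eta^i(Y))-Y(\eta^i(X))-\eta^i([X,Y])\},$$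 $$R_{X,Y}\,\xi_i=\kappa\{\bar\eta(X)f^2Y-\bar\eta(Y)f^2X\}+\mu\{\bar\eta(Y)h_iX-\bar\eta(X)h_iY\},$$ and that $\pounds_{\xi_i}Q=0$ for all $i$. Then $\kappa\le1$ and $\widetilde h_1=\dots=\widetilde h_s=:\widetilde h$. Suppose moreover that $\kappa<1$, and put $\lambda=\sqrt{1-\kappa}$. Then the eigenspaces of $\widetilde h$ for the eigenvalues $0,\lambda,-\lambda$ form smooth distributions $\mathcal D(0),\mathcal D(\lambda),\mathcal D(-\lambda)$ of ranks $s,n,n$, which are mutually orthogonal and satisfy $TM=\mathcal D(0)\oplus\mathcal D(\lambda)\oplus\mathcal D(-\lambda)$. If, in addition, $(\nabla_XQ)Y=0$ for all $X,Y\in\mathcal D$, then each of these three distributions is integrable, that is, through each point of $M$ there passes an integral manifold of it (an injectively immersed submanifold tangent to the distribution and of the same dimension). -/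

import Mathlib

open scoped Manifold ContDiff
open Bundle

noncomputable section

namespace WeakF

/-! ## Vector fields, tensor fields and the Levi-Civita connection -/

section Basic

variable {m : ℕ} {M : Type*} [TopologicalSpace M]
  [ChartedSpace (EuclideanSpace ℝ (Fin m)) M]

/-- The tangent space `T_x M` of an `m`-dimensional manifold. -/
abbrev Tan (m : ℕ) {M : Type*} [TopologicalSpace M]
    [ChartedSpace (EuclideanSpace ℝ (Fin m)) M] (x : M) : Type :=
  TangentSpace 𝓘(ℝ, EuclideanSpace ℝ (Fin m)) x

/-- (Not necessarily smooth) vector fields on `M`. -/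
abbrev VField (m : ℕ) (M : Type*) [TopologicalSpace M]
    [ChartedSpace (EuclideanSpace ℝ (Fin m)) M] : Type _ :=
  (x : M) → Tan m x

/-- (Not necessarily smooth) fields of endomorphisms of the tangent spaces. -/
abbrev EndField (m : ℕ) (M : Type*) [TopologicalSpace M]
    [ChartedSpace (EuclideanSpace ℝ (Fin m)) M] : Type _ :=
  (x : M) → (Tan m x →L[ℝ] Tan m x)

/-- (Not necessarily smooth) fields of covectors. -/
abbrev CovField (m : ℕ) (M : Type*) [TopologicalSpace M]
    [ChartedSpace (EuclideanSpace ℝ (Fin m)) M] : Type _ :=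
  (x : M) → (Tan m x →L[ℝ] ℝ)

/-- (Not necessarily smooth) fields of linear subspaces of the tangent spaces. -/
abbrev SubspaceField (m : ℕ) (M : Type*) [TopologicalSpace M]
    [ChartedSpace (EuclideanSpace ℝ (Fin m)) M] : Type _ :=
  (x : M) → Submodule ℝ (Tan m x)

variable [IsManifold 𝓘(ℝ, EuclideanSpace ℝ (Fin m)) ∞ M]

/-- The vector field `X` is smooth on the set `U`. -/
def SmoothVFieldOn (X : VField m M) (U : Set M) : Prop :=
  ContMDiffOn 𝓘(ℝ, EuclideanSpace ℝ (Fin m)) (𝓘(ℝ, EuclideanSpace ℝ (Fin m)).tangent) ∞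
    (fun x => (⟨x, X x⟩ : TangentBundle 𝓘(ℝ, EuclideanSpace ℝ (Fin m)) M)) U

/-- `X` is a smooth vector field on `M`. -/
def SmoothVField (X : VField m M) : Prop :=
  ContMDiff 𝓘(ℝ, EuclideanSpace ℝ (Fin m)) (𝓘(ℝ, EuclideanSpace ℝ (Fin m)).tangent) ∞
    (fun x => (⟨x, X x⟩ : TangentBundle 𝓘(ℝ, EuclideanSpace ℝ (Fin m)) M))

/-- The Lie bracket `[X, Y]` of vector fields. -/
abbrev bracket (X Y : VField m M) : VField m M :=
  VectorField.mlieBracket 𝓘(ℝ, EuclideanSpace ℝ (Fin m)) X Y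

/-- The derivative `X(φ)` of a function `φ` along a vector field `X`. -/
def dirDeriv (X : VField m M) (φ : M → ℝ) (x : M) : ℝ :=
  (mfderiv 𝓘(ℝ, EuclideanSpace ℝ (Fin m)) 𝓘(ℝ, ℝ) φ x : Tan m x → ℝ) (X x)

/-- The vector field `A X`, for a field of endomorphisms `A`. -/
def app (A : EndField m M) (X : VField m M) : VField m M := fun x => A x (X x)

/-- The Lie derivative of a `(1,1)`-tensor: `(£_Z A) X = [Z, A X] - A [Z, X]`. -/
def lieDeriv (Z : VField m M) (A : EndField m M) (X : VField m M) : VField m M :=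
  bracket Z (app A X) - app A (bracket Z X)

open Classical in
/-- The field of endomorphisms which represents an operator `T` on smooth vector fields that is
tensorial, that is, whose value `(T X)(x)` depends linearly on `X(x)` only. -/
def toEndField (T : VField m M → VField m M) : EndField m M := fun x =>
  if h : ∃ L : Tan m x →L[ℝ] Tan m x, ∀ X : VField m M, SmoothVField X → T X x = L (X x)
  then h.choose else 0

/-- The exterior derivative of a 1-form, normalised by
`dα(X,Y) = ½ {X(α(Y)) - Y(α(X)) - α([X,Y])}`. -/
def dOneForm (α : CovField m M) (X Y : VField m M) (x : M) : ℝ :=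
  (1 / 2) * (dirDeriv X (fun y => α y (Y y)) x - dirDeriv Y (fun y => α y (X y)) x
    - α x (bracket X Y x))

/-- Smooth `(1,1)`-tensor fields: smooth sections of `End(TM)`. -/
def SmoothEndField (A : EndField m M) : Prop :=
  ContMDiff 𝓘(ℝ, EuclideanSpace ℝ (Fin m))
    (𝓘(ℝ, EuclideanSpace ℝ (Fin m)).prod
      𝓘(ℝ, EuclideanSpace ℝ (Fin m) →L[ℝ] EuclideanSpace ℝ (Fin m))) ∞
    (fun x => TotalSpace.mk' (EuclideanSpace ℝ (Fin m) →L[ℝ] EuclideanSpace ℝ (Fin m))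
      (E := fun x : M => (TangentSpace 𝓘(ℝ, EuclideanSpace ℝ (Fin m)) x →L[ℝ]
        TangentSpace 𝓘(ℝ, EuclideanSpace ℝ (Fin m)) x)) x (A x))

/-- Smooth 1-forms: smooth sections of the cotangent bundle. -/
def SmoothCovField (α : CovField m M) : Prop :=
  ContMDiff 𝓘(ℝ, EuclideanSpace ℝ (Fin m))
    (𝓘(ℝ, EuclideanSpace ℝ (Fin m)).prod 𝓘(ℝ, EuclideanSpace ℝ (Fin m) →L[ℝ] ℝ)) ∞
    (fun x => TotalSpace.mk' (EuclideanSpace ℝ (Fin m) →L[ℝ] ℝ)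
      (E := fun x : M => (TangentSpace 𝓘(ℝ, EuclideanSpace ℝ (Fin m)) x →L[ℝ]
        Bundle.Trivial M ℝ x)) x (α x))

/-- Smooth Riemannian metrics on `M`. -/
abbrev Metric (m : ℕ) (M : Type*) [TopologicalSpace M]
    [ChartedSpace (EuclideanSpace ℝ (Fin m)) M]
    [IsManifold 𝓘(ℝ, EuclideanSpace ℝ (Fin m)) ∞ M] : Type _ :=
  ContMDiffRiemannianMetric 𝓘(ℝ, EuclideanSpace ℝ (Fin m)) ∞ (EuclideanSpace ℝ (Fin m))
    (fun x : M => TangentSpace 𝓘(ℝ, EuclideanSpace ℝ (Fin m)) x)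

/-- The function `g(X, Y)`. -/
def ip (g : Metric m M) (X Y : VField m M) (x : M) : ℝ := g.inner x (X x) (Y x)

/-- The right-hand side of the Koszul formula for `2 g(∇_X Y, Z)`. -/
def koszul (g : Metric m M) (X Y Z : VField m M) (x : M) : ℝ :=
  dirDeriv X (ip g Y Z) x + dirDeriv Y (ip g Z X) x - dirDeriv Z (ip g X Y) x
    + ip g (bracket X Y) Z x - ip g (bracket Y Z) X x + ip g (bracket Z X) Y x

open Classical in
/-- The Levi-Civita connection of `g`: at the point `x`, `∇_X Y` is the vector `w` with
`2 g(w, Z) = koszul g X Y Z` for all smooth vector fields `Z`. (For smooth `X`, `Y` there is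
exactly one such `w`.) -/
def nabla (g : Metric m M) (X Y : VField m M) : VField m M := fun x =>
  if h : ∃ w : Tan m x, ∀ Z : VField m M, SmoothVField Z →
      2 * g.inner x w (Z x) = koszul g X Y Z x
  then h.choose else 0

/-- The covariant derivative of a `(1,1)`-tensor: `(∇_X A) Y = ∇_X (A Y) - A (∇_X Y)`. -/
def nablaEnd (g : Metric m M) (X : VField m M) (A : EndField m M) (Y : VField m M) :
    VField m M :=
  nabla g X (app A Y) - app A (nabla g X Y)

/-- The curvature tensor `R_{X,Y} Z = ∇_X ∇_Y Z - ∇_Y ∇_X Z - ∇_{[X,Y]} Z`. -/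
def curv (g : Metric m M) (X Y Z : VField m M) : VField m M :=
  nabla g X (nabla g Y Z) - nabla g Y (nabla g X Z) - nabla g (bracket X Y) Z

/-- `D` is a smooth distribution of rank `k`: locally it is spanned by `k` smooth, pointwise
linearly independent vector fields. -/
def IsDistribution (k : ℕ) (D : SubspaceField m M) : Prop :=
  ∀ x : M, ∃ U : Set M, IsOpen U ∧ x ∈ U ∧ ∃ V : Fin k → VField m M,
    (∀ a, SmoothVFieldOn (V a) U) ∧
    ∀ y ∈ U, LinearIndependent ℝ (fun a => V a y) ∧
      Submodule.span ℝ (Set.range fun a => V a y) = D y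

/-- The rank `k` distribution `D` is integrable: through each point `x` of `M` there passes an
integral manifold, that is, an injectively immersed `k`-dimensional submanifold whose tangent space
at each of its points `y` is `D y`. -/
def IsIntegrable (k : ℕ) (D : SubspaceField m M) : Prop :=
  ∀ x : M, ∃ (U : Set (EuclideanSpace ℝ (Fin k))) (φ : EuclideanSpace ℝ (Fin k) → M),
    IsOpen U ∧ 0 ∈ U ∧ φ 0 = x ∧ Set.InjOn φ U ∧
    ContMDiffOn 𝓘(ℝ, EuclideanSpace ℝ (Fin k)) 𝓘(ℝ, EuclideanSpace ℝ (Fin m)) ∞ φ U ∧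
    ∀ u ∈ U,
      Function.Injective
        (mfderiv 𝓘(ℝ, EuclideanSpace ℝ (Fin k)) 𝓘(ℝ, EuclideanSpace ℝ (Fin m)) φ u) ∧
      (mfderiv 𝓘(ℝ, EuclideanSpace ℝ (Fin k)) 𝓘(ℝ, EuclideanSpace ℝ (Fin m)) φ u).range
        = D (φ u)

end Basic

/-! ## Weak metric `f`-structures -/

/-- A weak metric `f`-structure `(f, Q, ξ_i, η^i, g)` on a manifold of dimension `2n + s`. -/
structure WeakMetricFStructure (n s : ℕ) (M : Type*) [TopologicalSpace M]
    [ChartedSpace (EuclideanSpace ℝ (Fin (2 * n + s))) M]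
    [IsManifold 𝓘(ℝ, EuclideanSpace ℝ (Fin (2 * n + s))) ∞ M] where
  f : EndField (2 * n + s) M
  Q : EndField (2 * n + s) M
  ξ : Fin s → VField (2 * n + s) M
  η : Fin s → CovField (2 * n + s) M
  g : Metric (2 * n + s) M
  smooth_f : SmoothEndField f
  smooth_Q : SmoothEndField Q
  smooth_ξ : ∀ i, SmoothVField (ξ i)
  smooth_η : ∀ i, SmoothCovField (η i)
  rank_f : ∀ x, Module.finrank ℝ (f x).range = 2 * n
  nonsingular_Q : ∀ x, Function.Bijective (Q x)
  f_sq : ∀ x (v : Tan (2 * n + s) x), f x (f x v) = -(Q x v) + ∑ i, η i x v • ξ i x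
  η_ξ : ∀ i j x, η i x (ξ j x) = if i = j then 1 else 0
  Q_ξ : ∀ i x, Q x (ξ i x) = ξ i x
  /-- the compatibility of the metric -/
  compatible : ∀ x (v w : Tan (2 * n + s) x),
    g.inner x (f x v) (f x w) = g.inner x v (Q x w) - ∑ i, η i x v * η i x w
  /-- the contact distribution `D = ⋂ ker η^i` is `f`-invariant -/
  invariant : ∀ x (v : Tan (2 * n + s) x), (∀ i, η i x v = 0) → ∀ i, η i x (f x v) = 0

namespace WeakMetricFStructure

variable {n s : ℕ} {M : Type*} [TopologicalSpace M]
  [ChartedSpace (EuclideanSpace ℝ (Fin (2 * n + s))) M]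
  [IsManifold 𝓘(ℝ, EuclideanSpace ℝ (Fin (2 * n + s))) ∞ M]
  (S : WeakMetricFStructure n s M)

/-- Weak almost `𝒮`-structures: `Φ = dη^1 = … = dη^s`, where `Φ(X,Y) = g(X, fY)`. -/
def IsWeakAlmostS : Prop :=
  ∀ i, ∀ X Y : VField (2 * n + s) M, SmoothVField X → SmoothVField Y → ∀ x,
    ip S.g X (app S.f Y) x = dOneForm (S.η i) X Y x

/-- `η̄ = ∑ η^i`. -/
def ηbar (x : M) (v : Tan (2 * n + s) x) : ℝ := ∑ i, S.η i x v

/-- The tensor `h_i = ½ £_{ξ_i} f`. -/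
def h (i : Fin s) : EndField (2 * n + s) M :=
  toEndField fun X => (1 / 2 : ℝ) • lieDeriv (S.ξ i) S.f X

/-- The tensor `h̃_i = Q⁻¹ h_i`. -/
def htilde (i : Fin s) : EndField (2 * n + s) M := fun x =>
  (S.Q x).inverse ∘L S.h i x

/-- The `(κ,μ)`-nullity condition. -/
def IsNullity (κ μ : ℝ) : Prop :=
  ∀ i, ∀ X Y : VField (2 * n + s) M, SmoothVField X → SmoothVField Y → ∀ x,
    curv S.g X Y (S.ξ i) x =
      κ • (S.ηbar x (X x) • S.f x (S.f x (Y x)) - S.ηbar x (Y x) • S.f x (S.f x (X x)))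
      + μ • (S.ηbar x (Y x) • S.h i x (X x) - S.ηbar x (X x) • S.h i x (Y x))

/-- Weak `f`-`(κ,μ)`-manifolds. -/
def IsWeakFKappaMu (κ μ : ℝ) : Prop := S.IsWeakAlmostS ∧ S.IsNullity κ μ

/-- The condition `£_{ξ_i} Q = 0` for all `i`. -/
def LieQVanishes : Prop :=
  ∀ i, ∀ X : VField (2 * n + s) M, SmoothVField X → lieDeriv (S.ξ i) S.Q X = 0

/-- `X` is a section of the contact distribution `D = ⋂ ker η^i`. -/
def IsHorizontal (X : VField (2 * n + s) M) : Prop := ∀ i x, S.η i x (X x) = 0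

/-- The condition `(∇_X Q) Y = 0` for all `X, Y ∈ D`. -/
def NablaQVanishes : Prop :=
  ∀ X Y : VField (2 * n + s) M, SmoothVField X → SmoothVField Y →
    S.IsHorizontal X → S.IsHorizontal Y → nablaEnd S.g X S.Q Y = 0

/-- The field of eigenspaces of `h̃_i` for the number `c`. -/
def eigenDist (i : Fin s) (c : ℝ) : SubspaceField (2 * n + s) M := fun x =>
  Module.End.eigenspace (S.htilde i x : Tan (2 * n + s) x →ₗ[ℝ] Tan (2 * n + s) x) c

/-- The fields of subspaces `A` and `B` are orthogonal. -/
def Orthogonal (A B : SubspaceField (2 * n + s) M) : Prop :=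
  ∀ x, ∀ v ∈ A x, ∀ w ∈ B x, S.g.inner x v w = 0

end WeakMetricFStructure

end WeakF

end

/-! Write `Φ(X,Y) = g(X, fY)`. Since `dη^k = Φ` and `Φ(ξ_i, ·) = 0`, Lie differentiation along `ξ_i`
kills every `η^k`, every `ξ_j` and `Φ` itself. With `£_{ξ_i} Q = 0`, differentiating the algebraic
identities of the structure shows that `h_i` anticommutes with `f`, commutes with `Q`, is
self-adjoint and annihilates the `ξ_j`. Because `£_{ξ_i} g` is then expressed by `h_i`, one gets
`∇_X ξ_i = -(f + f h̃_i) X` (`nabla_ξ`).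

Inserting this into the nullity condition for `R_{X,ξ_j} ξ_i` gives an identity that still contains
`£_{ξ_j} h̃_i`. Adding its value at `fX` to `f` of its value at `X` cancels the Lie derivative and
the `μ`-terms and leaves `h̃_i h̃_j = (1 - κ) · proj`, with `proj` the projection to the contact
distribution (`h_htilde`). As the `h̃_i` are self-adjoint, `κ ≤ 1` and `h̃_i = h̃_j` follow from
positivity of `g`. For `κ < 1` the spectral decomposition is linear algebra: the kernel of `h̃` is
spanned by the `ξ_j`, and `f` exchanges the eigenspaces for `±λ`, so each has dimension `n`. The
projectors `½ (proj ± λ⁻¹ h̃)` carry smooth fields to smooth fields, which provides frames.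

For integrability, `R_{X,Y} ξ_i = 0` for horizontal `X, Y` is a Codazzi equation for `A = f + f h̃`.
On `D(c)` with `c = ±λ` put `T(X,Y,W) = g((∇_X A) Y, W)`. Codazzi on `D(c)` makes `T` symmetric in
`X, Y`; Codazzi between `D(c)` and `D(-c) = f D(c)`, together with `∇Q = 0`, makes it skew in `X,
W`. Hence `T = 0`, and this forces `∇_X Y` to have no component in `D(-c)`
(`inner_nabla_f_eq_zero`). So `D(c)` is involutive; `D(0)` is involutive because the `ξ_i` commute.
The Frobenius theorem, proved here by solving `dφ = F ∘ φ` along rays, gives the integral manifolds.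
-/

noncomputable section

namespace WeakF

/-! ### Calculus of smooth functions, vector fields and brackets. -/

section Calculus

variable {m : ℕ} {M : Type*} [TopologicalSpace M]
  [ChartedSpace (EuclideanSpace ℝ (Fin m)) M]

instance (x : M) : FiniteDimensional ℝ (Tan m x) :=
  inferInstanceAs (FiniteDimensional ℝ (EuclideanSpace ℝ (Fin m)))

instance (x : M) : T2Space (Tan m x) :=
  inferInstanceAs (T2Space (EuclideanSpace ℝ (Fin m)))

theorem finrank_tan (x : M) : Module.finrank ℝ (Tan m x) = m :=
  (finrank_euclideanSpace_fin : Module.finrank ℝ (EuclideanSpace ℝ (Fin m)) = m)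

/-- The real function `φ` is differentiable at `x`. -/
abbrev MDiffFunAt (m : ℕ) {M : Type*} [TopologicalSpace M]
    [ChartedSpace (EuclideanSpace ℝ (Fin m)) M] (φ : M → ℝ) (x : M) : Prop :=
  MDifferentiableAt 𝓘(ℝ, EuclideanSpace ℝ (Fin m)) 𝓘(ℝ, ℝ) φ x

/-- The real function `φ` is smooth. -/
abbrev SmoothFun (m : ℕ) {M : Type*} [TopologicalSpace M]
    [ChartedSpace (EuclideanSpace ℝ (Fin m)) M] (φ : M → ℝ) : Prop :=
  ContMDiff 𝓘(ℝ, EuclideanSpace ℝ (Fin m)) 𝓘(ℝ, ℝ) ∞ φ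

theorem dirDeriv_eq (X : VField m M) (φ : M → ℝ) (x : M) :
    dirDeriv X φ x = mvfderiv 𝓘(ℝ, EuclideanSpace ℝ (Fin m)) φ x (X x) := rfl

theorem SmoothFun.mdiffAt {φ : M → ℝ} (h : SmoothFun m φ) (x : M) : MDiffFunAt m φ x :=
  h.mdifferentiable (by simp) x

theorem dirDeriv_add_fun {X : VField m M} {φ ψ : M → ℝ} {x : M} (hφ : MDiffFunAt m φ x)
    (hψ : MDiffFunAt m ψ x) :
    dirDeriv X (fun y => φ y + ψ y) x = dirDeriv X φ x + dirDeriv X ψ x := by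
  simp [dirDeriv_eq, mvfderiv_fun_add hφ hψ]

theorem dirDeriv_mul_fun {X : VField m M} {φ ψ : M → ℝ} {x : M} (hφ : MDiffFunAt m φ x)
    (hψ : MDiffFunAt m ψ x) :
    dirDeriv X (fun y => φ y * ψ y) x = φ x * dirDeriv X ψ x + ψ x * dirDeriv X φ x := by
  simp [dirDeriv_eq, mvfderiv_fun_mul hφ hψ]

theorem dirDeriv_const (X : VField m M) (c : ℝ) (x : M) : dirDeriv X (fun _ => c) x = 0 := by
  unfold dirDeriv
  rw [mfderiv_const]; rfl

theorem dirDeriv_const_mul {X : VField m M} {φ : M → ℝ} {x : M} (c : ℝ)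
    (hφ : MDiffFunAt m φ x) : dirDeriv X (fun y => c * φ y) x = c * dirDeriv X φ x := by
  rw [dirDeriv_mul_fun mdifferentiableAt_const hφ, dirDeriv_const]; ring

theorem dirDeriv_neg_fun {X : VField m M} {φ : M → ℝ} {x : M}
    (hφ : MDiffFunAt m φ x) : dirDeriv X (fun y => - φ y) x = - dirDeriv X φ x := by
  simpa using dirDeriv_const_mul (X := X) (-1) hφ

theorem dirDeriv_sub_fun {X : VField m M} {φ ψ : M → ℝ} {x : M} (hφ : MDiffFunAt m φ x)
    (hψ : MDiffFunAt m ψ x) :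
    dirDeriv X (fun y => φ y - ψ y) x = dirDeriv X φ x - dirDeriv X ψ x := by
  simpa [sub_eq_add_neg, dirDeriv_neg_fun hψ] using
    dirDeriv_add_fun (X := X) hφ (ψ := fun y => - ψ y) hψ.neg

theorem bracket_swap (X Y : VField m M) : bracket X Y = - bracket Y X :=
  VectorField.mlieBracket_swap

variable [IsManifold 𝓘(ℝ, EuclideanSpace ℝ (Fin m)) ∞ M]

/-- The vector field `X` is differentiable at `x`. -/
abbrev MDiffVFieldAt (X : VField m M) (x : M) : Prop :=
  MDifferentiableAt 𝓘(ℝ, EuclideanSpace ℝ (Fin m)) (𝓘(ℝ, EuclideanSpace ℝ (Fin m)).tangent)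
    (fun x => (⟨x, X x⟩ : TangentBundle 𝓘(ℝ, EuclideanSpace ℝ (Fin m)) M)) x

theorem SmoothVField.mdiffAt {X : VField m M} (hX : SmoothVField X) (x : M) :
    MDiffVFieldAt X x :=
  ContMDiff.mdifferentiable hX (by simp) x

theorem SmoothVField.add {X Y : VField m M} (hX : SmoothVField X) (hY : SmoothVField Y) :
    SmoothVField (X + Y) := ContMDiff.add_section hX hY

theorem SmoothVField.sub {X Y : VField m M} (hX : SmoothVField X) (hY : SmoothVField Y) :
    SmoothVField (X - Y) := ContMDiff.sub_section hX hY

theorem SmoothVField.neg {X : VField m M} (hX : SmoothVField X) :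
    SmoothVField (-X) := ContMDiff.neg_section hX

theorem SmoothVField.const_smul {X : VField m M} (c : ℝ) (hX : SmoothVField X) :
    SmoothVField (c • X) := ContMDiff.const_smul_section hX

theorem SmoothVField.smul {X : VField m M} {φ : M → ℝ} (hφ : SmoothFun m φ)
    (hX : SmoothVField X) : SmoothVField (φ • X) := ContMDiff.smul_section hφ hX

theorem SmoothVField.zero : SmoothVField (0 : VField m M) := contMDiff_zeroSection _ _

theorem SmoothVField.sum {ι : Type*} {s : Finset ι} {X : ι → VField m M}
    (hX : ∀ i ∈ s, SmoothVField (X i)) : SmoothVField (∑ i ∈ s, X i) := by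
  classical
  induction s using Finset.induction_on with
  | empty => simpa using SmoothVField.zero
  | insert a s ha ih =>
    rw [Finset.sum_insert ha]
    exact (hX a (by simp)).add (ih fun i hi => hX i (by simp [hi]))

theorem SmoothVField.app {A : EndField m M} (hA : SmoothEndField A) {X : VField m M}
    (hX : SmoothVField X) : SmoothVField (app A X) :=
  ContMDiff.clm_bundle_apply hA hX

theorem SmoothEndField.mdiffAt_app {A : EndField m M} (hA : SmoothEndField A) {X : VField m M}
    {x : M} (hX : MDiffVFieldAt X x) : MDiffVFieldAt (WeakF.app A X) x :=
  MDifferentiableAt.clm_bundle_apply (ContMDiff.mdifferentiable hA (by simp) x) hX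

theorem SmoothCovField.apply {α : CovField m M} (hα : SmoothCovField α) {X : VField m M}
    (hX : SmoothVField X) : SmoothFun m (fun x => α x (X x)) := by
  have := ContMDiff.clm_bundle_apply hα hX
  exact fun x => (Bundle.contMDiffAt_section x).1 (this x)

theorem smooth_ip (g : Metric m M) {X Y : VField m M} (hX : SmoothVField X)
    (hY : SmoothVField Y) : SmoothFun m (ip g X Y) := by
  have := ContMDiff.clm_bundle_apply₂ (F₃ := ℝ) (E₃ := Bundle.Trivial M ℝ) g.contMDiff hX hY
  exact fun x => (Bundle.contMDiffAt_section x).1 (this x)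

theorem mdiffAt_ip (g : Metric m M) {X Y : VField m M} {x : M} (hX : MDiffVFieldAt X x)
    (hY : MDiffVFieldAt Y x) : MDiffFunAt m (ip g X Y) x := by
  have := MDifferentiableAt.clm_bundle_apply₂ (F₃ := ℝ) (E₃ := Bundle.Trivial M ℝ)
    (g.contMDiff.mdifferentiable (by simp) x) hX hY
  exact (mdifferentiableAt_section _ _).1 this

instance : IsManifold 𝓘(ℝ, EuclideanSpace ℝ (Fin m)) (minSmoothness ℝ 3) M := by
  rw [minSmoothness_of_isRCLikeNormedField]; infer_instance

instance : IsManifold 𝓘(ℝ, EuclideanSpace ℝ (Fin m)) (minSmoothness ℝ 2) M := by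
  rw [minSmoothness_of_isRCLikeNormedField]; infer_instance

theorem SmoothVField.bracket {X Y : VField m M} (hX : SmoothVField X) (hY : SmoothVField Y) :
    SmoothVField (bracket X Y) := by
  have : IsManifold 𝓘(ℝ, EuclideanSpace ℝ (Fin m)) (((⊤ : ℕ∞) : WithTop ℕ∞) + 1) M :=
    inferInstanceAs (IsManifold 𝓘(ℝ, EuclideanSpace ℝ (Fin m)) ∞ M)
  refine ContDiff.mlieBracket_vectorField (m := ⊤) (n := ⊤) hX hY ?_
  rw [minSmoothness_of_isRCLikeNormedField]; rfl

theorem bracket_add_right (X : VField m M) {Y Z : VField m M} (hY : SmoothVField Y)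
    (hZ : SmoothVField Z) : bracket X (Y + Z) = bracket X Y + bracket X Z :=
  funext fun x => VectorField.mlieBracket_add_right (hY.mdiffAt x) (hZ.mdiffAt x)

theorem bracket_const_smul_right (X : VField m M) {Y : VField m M} (c : ℝ)
    (hY : SmoothVField Y) : bracket X (c • Y) = c • bracket X Y :=
  funext fun x => VectorField.mlieBracket_const_smul_right (hY.mdiffAt x)

theorem bracket_neg_right (X : VField m M) {Y : VField m M}
    (hY : SmoothVField Y) : bracket X (-Y) = - bracket X Y := by
  simpa using bracket_const_smul_right X (-1) hY

theorem bracket_smul_right (X : VField m M) {Y : VField m M} {φ : M → ℝ} (hφ : SmoothFun m φ)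
    (hY : SmoothVField Y) (x : M) :
    bracket X (φ • Y) x = dirDeriv X φ x • Y x + φ x • bracket X Y x :=
  VectorField.mlieBracket_smul_right (SmoothFun.mdiffAt hφ x) (hY.mdiffAt x)

theorem bracket_sum_right (X : VField m M) {ι : Type*} {s : Finset ι} {Y : ι → VField m M}
    (hY : ∀ i ∈ s, SmoothVField (Y i)) :
    bracket X (∑ i ∈ s, Y i) = ∑ i ∈ s, bracket X (Y i) := by
  classical
  induction s using Finset.induction_on with
  | empty => simp
  | insert a s ha ih =>
    rw [Finset.sum_insert ha, Finset.sum_insert ha, bracket_add_right X (hY a (by simp))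
      (SmoothVField.sum fun i hi => hY i (by simp [hi])), ih fun i hi => hY i (by simp [hi])]

theorem jacobi {X Y Z : VField m M} (hX : SmoothVField X) (hY : SmoothVField Y)
    (hZ : SmoothVField Z) :
    bracket X (bracket Y Z) = bracket (bracket X Y) Z + bracket Y (bracket X Z) :=
  VectorField.leibniz_identity_mlieBracket
    (ContMDiff.of_le hX (by rw [minSmoothness_of_isRCLikeNormedField]; exact WithTop.coe_le_coe.2 le_top))
    (ContMDiff.of_le hY (by rw [minSmoothness_of_isRCLikeNormedField]; exact WithTop.coe_le_coe.2 le_top))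
    (ContMDiff.of_le hZ (by rw [minSmoothness_of_isRCLikeNormedField]; exact WithTop.coe_le_coe.2 le_top))

/-- A local extension of `v` is cut off by a bump function. This lets pointwise tensor identities be
tested on global smooth fields. -/
theorem exists_smoothVField_eq [T2Space M] (x : M) (v : Tan m x) :
    ∃ X : VField m M, SmoothVField X ∧ X x = v := by
  obtain ⟨s, hs, hsm⟩ := FiberBundle.exists_contMDiffOn_extend (k := ∞)
    𝓘(ℝ, EuclideanSpace ℝ (Fin m)) (EuclideanSpace ℝ (Fin m)) v
  obtain ⟨u, hus, hu, hxu⟩ := mem_nhds_iff.1 hs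
  obtain ⟨f, -, hf⟩ := (SmoothBumpFunction.nhds_basis_tsupport
    (I := 𝓘(ℝ, EuclideanSpace ℝ (Fin m))) x).mem_iff.1 (hu.mem_nhds hxu)
  refine ⟨(f : M → ℝ) • FiberBundle.extend (EuclideanSpace ℝ (Fin m)) v,
    ContMDiffOn.smul_section_of_tsupport f.contMDiff.contMDiffOn hu hf (hsm.mono hus), ?_⟩
  simp

theorem SmoothFun.dirDeriv {X : VField m M} (hX : SmoothVField X) {φ : M → ℝ}
    (hφ : SmoothFun m φ) : SmoothFun m (dirDeriv X φ) := by
  have h := (ContMDiff.contMDiff_tangentMap hφ (m := ∞) le_rfl).comp hX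
  exact (contMDiff_snd_tangentBundle_modelSpace ℝ 𝓘(ℝ, ℝ)).comp h

/-- The bracket of vector fields is the commutator of the corresponding derivations. -/
theorem dirDeriv_bracket [T2Space M] {X Y : VField m M} (hX : SmoothVField X)
    (hY : SmoothVField Y) {φ : M → ℝ} (hφ : SmoothFun m φ) (x : M) :
    dirDeriv (bracket X Y) φ x =
      dirDeriv X (WeakF.dirDeriv Y φ) x - dirDeriv Y (WeakF.dirDeriv X φ) x := by
  by_contra hne
  -- Expanding the Jacobi identity for `X, Y, φZ` leaves the difference of the two sides times `Z
  -- x`, which is therefore zero. If that difference is nonzero, the tangent space at `x` is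
  -- trivial, and then both sides vanish after all.
  have key : ∀ v : Tan m x, v = 0 := by
    intro v
    obtain ⟨Z, hZ, rfl⟩ := exists_smoothVField_eq x v
    have hφY := SmoothFun.dirDeriv hY hφ
    have hφX := SmoothFun.dirDeriv hX hφ
    have e1 : ∀ W : VField m M, SmoothVField W →
        bracket W (φ • Z) = WeakF.dirDeriv W φ • Z + φ • bracket W Z := fun W _ =>
      funext fun y => bracket_smul_right W hφ hZ y
    have h := congrFun (jacobi hX hY (hZ.smul hφ)) x
    rw [e1 Y hY, e1 X hX, bracket_add_right _ (hZ.smul hφY) ((hY.bracket hZ).smul hφ),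
      bracket_add_right _ (hZ.smul hφX) ((hX.bracket hZ).smul hφ)] at h
    simp only [Pi.add_apply] at h
    rw [bracket_smul_right _ hφ hZ, bracket_smul_right _ hφY hZ, bracket_smul_right _ hφX hZ,
      bracket_smul_right _ hφ (hY.bracket hZ), bracket_smul_right _ hφ (hX.bracket hZ),
      congrFun (jacobi hX hY hZ) x, Pi.add_apply] at h
    have h2 : (WeakF.dirDeriv (bracket X Y) φ x -
        (WeakF.dirDeriv X (WeakF.dirDeriv Y φ) x - WeakF.dirDeriv Y (WeakF.dirDeriv X φ) x)) •
          Z x = 0 := by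
      rw [← sub_eq_zero] at h
      rw [← neg_zero, ← h]
      module
    exact (smul_eq_zero.1 h2).resolve_left (sub_ne_zero.2 hne)
  apply hne
  simp only [dirDeriv_eq, key (bracket X Y x), key (X x), key (Y x), map_zero, sub_zero]

end Calculus

/-! ### The Levi-Civita connection from the Koszul formula. -/

section LeviCivita

variable {m : ℕ} {M : Type*} [TopologicalSpace M]
  [ChartedSpace (EuclideanSpace ℝ (Fin m)) M]
  [IsManifold 𝓘(ℝ, EuclideanSpace ℝ (Fin m)) ∞ M]

theorem ip_comm (g : Metric m M) (X Y : VField m M) : ip g X Y = ip g Y X :=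
  funext fun x => g.symm x _ _

theorem metric_ext (g : Metric m M) {x : M} {v w : Tan m x}
    (h : ∀ u, g.inner x v u = g.inner x w u) : v = w := by
  by_contra hne
  have := g.pos x (v - w) (sub_ne_zero.2 hne)
  rw [map_sub (g.inner x), sub_apply, h, sub_self] at this
  exact lt_irrefl _ this

theorem metric_eq_zero (g : Metric m M) {x : M} {v : Tan m x} (h : g.inner x v v = 0) :
    v = 0 := by
  by_contra hne
  exact (g.pos x v hne).ne' h

/-- Every covector is represented by a vector. -/
theorem metric_exists_repr (g : Metric m M) (x : M) (α : Tan m x →L[ℝ] ℝ) :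
    ∃ w, ∀ u, g.inner x w u = α u := by
  let T : Tan m x →ₗ[ℝ] Module.Dual ℝ (Tan m x) :=
    { toFun := fun v => (g.inner x v : Tan m x →ₗ[ℝ] ℝ)
      map_add' := fun v w => by ext u; simp
      map_smul' := fun c v => by ext u; simp }
  have hinj : Function.Injective T := fun v w h => metric_ext g fun u => LinearMap.congr_fun h u
  obtain ⟨w, hw⟩ := (LinearMap.injective_iff_surjective_of_finrank_eq_finrank
    (Subspace.dual_finrank_eq (K := ℝ) (V := Tan m x)).symm).1 hinj (α : Tan m x →ₗ[ℝ] ℝ)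
  exact ⟨w, fun u => LinearMap.congr_fun hw u⟩

/-- The derivatives of `φ` produced by the product rule cancel against those produced by the
brackets. Hence the Koszul expression is a covector in `Z`, and the metric represents it by a
vector. -/
theorem tensorialAt_koszul (g : Metric m M) {X Y : VField m M} (hX : SmoothVField X)
    (hY : SmoothVField Y) (x : M) :
    TensorialAt 𝓘(ℝ, EuclideanSpace ℝ (Fin m)) (EuclideanSpace ℝ (Fin m))
      (fun Z : VField m M => koszul g X Y Z x) x where
  smul := by
    intro φ Z hφ hZ
    have e1 : ip g Y (φ • Z) = fun y => φ y * ip g Y Z y := by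
      funext y; simp [ip]
    have e2 : ip g (φ • Z) X = fun y => φ y * ip g Z X y := by
      funext y; simp [ip]
    have b1 : bracket Y (φ • Z) x = dirDeriv Y φ x • Z x + φ x • bracket Y Z x :=
      VectorField.mlieBracket_smul_right hφ hZ
    have b2 : bracket (φ • Z) X x = -(dirDeriv X φ x) • Z x + φ x • bracket Z X x :=
      VectorField.mlieBracket_smul_left hφ hZ
    have d : dirDeriv (φ • Z) (ip g X Y) x = φ x * dirDeriv Z (ip g X Y) x := by
      simp [dirDeriv_eq]
    simp only [koszul]
    rw [e1, e2, dirDeriv_mul_fun hφ (mdiffAt_ip g (hY.mdiffAt x) hZ),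
      dirDeriv_mul_fun hφ (mdiffAt_ip g hZ (hX.mdiffAt x)), d]
    simp only [ip, b1, b2, map_add, map_smul, add_apply, smul_apply, Pi.smul_apply', smul_eq_mul]
    rw [g.symm x (Z x) (X x), g.symm x (Z x) (Y x)]
    ring
  add := by
    intro Z W hZ hW
    have e1 : ip g Y (Z + W) = fun y => ip g Y Z y + ip g Y W y := by
      funext y; simp [ip]
    have e2 : ip g (Z + W) X = fun y => ip g Z X y + ip g W X y := by
      funext y; simp [ip]
    have b1 : bracket Y (Z + W) x = bracket Y Z x + bracket Y W x :=
      VectorField.mlieBracket_add_right hZ hW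
    have b2 : bracket (Z + W) X x = bracket Z X x + bracket W X x :=
      VectorField.mlieBracket_add_left hZ hW
    have d : dirDeriv (Z + W) (ip g X Y) x =
        dirDeriv Z (ip g X Y) x + dirDeriv W (ip g X Y) x := by
      simp [dirDeriv_eq]
    simp only [koszul]
    rw [e1, e2, dirDeriv_add_fun (mdiffAt_ip g (hY.mdiffAt x) hZ) (mdiffAt_ip g (hY.mdiffAt x) hW),
      dirDeriv_add_fun (mdiffAt_ip g hZ (hX.mdiffAt x)) (mdiffAt_ip g hW (hX.mdiffAt x)), d]
    simp only [ip, b1, b2, map_add, add_apply, Pi.add_apply]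
    ring

theorem nabla_spec (g : Metric m M) {X Y Z : VField m M} (hX : SmoothVField X)
    (hY : SmoothVField Y) (hZ : SmoothVField Z) (x : M) :
    2 * g.inner x (nabla g X Y x) (Z x) = koszul g X Y Z x := by
  have h : ∃ w : Tan m x, ∀ Z : VField m M, SmoothVField Z →
      2 * g.inner x w (Z x) = koszul g X Y Z x := by
    have ht := tensorialAt_koszul g hX hY x
    obtain ⟨w, hw⟩ := metric_exists_repr g x (TensorialAt.mkHom _ x ht)
    refine ⟨(1 / 2 : ℝ) • w, fun Z hZ => ?_⟩
    rw [map_smul, smul_apply, hw, TensorialAt.mkHom_apply ht (hZ.mdiffAt x), smul_eq_mul]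
    ring
  have e : nabla g X Y x = h.choose := dif_pos h
  rw [e]
  exact h.choose_spec Z hZ

/-- Sum of the Koszul formulas for `(X, Y, Z)` and `(X, Z, Y)`. -/
theorem nabla_compat (g : Metric m M) {X Y Z : VField m M} (hX : SmoothVField X)
    (hY : SmoothVField Y) (hZ : SmoothVField Z) (x : M) :
    dirDeriv X (ip g Y Z) x =
      g.inner x (nabla g X Y x) (Z x) + g.inner x (Y x) (nabla g X Z x) := by
  have h1 := nabla_spec g hX hY hZ x
  have h2 := nabla_spec g hX hZ hY x
  rw [g.symm x (nabla g X Z x)] at h2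
  simp only [koszul, ip_comm g Z, ip_comm g Y X, bracket_swap Y X, bracket_swap Z Y,
    bracket_swap Z X] at h1 h2
  simp only [ip, Pi.neg_apply, map_neg, neg_apply] at h1 h2 ⊢
  linarith

variable [T2Space M]

theorem metric_ext_smooth (g : Metric m M) {x : M} {v w : Tan m x}
    (h : ∀ Z : VField m M, SmoothVField Z → g.inner x v (Z x) = g.inner x w (Z x)) : v = w := by
  refine metric_ext g fun u => ?_
  obtain ⟨Z, hZ, rfl⟩ := exists_smoothVField_eq x u
  exact h Z hZ

/-- Difference of the Koszul formulas for `(X, Y, Z)` and `(Y, X, Z)`. -/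
theorem nabla_torsion (g : Metric m M) {X Y : VField m M} (hX : SmoothVField X)
    (hY : SmoothVField Y) : nabla g X Y = nabla g Y X + bracket X Y := by
  funext x
  refine metric_ext_smooth g fun Z hZ => ?_
  have h1 := nabla_spec g hX hY hZ x
  have h2 := nabla_spec g hY hX hZ x
  simp only [koszul, ip_comm g Z, ip_comm g Y X, bracket_swap Y X, bracket_swap Z Y,
    bracket_swap Z X] at h1 h2
  simp only [ip, Pi.neg_apply, map_neg, neg_apply, Pi.add_apply, map_add, add_apply] at h1 h2 ⊢
  linarith

theorem nabla_const_smul (g : Metric m M) {X Y : VField m M} (c : ℝ) (hX : SmoothVField X)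
    (hY : SmoothVField Y) : nabla g X (c • Y) = c • nabla g X Y := by
  funext x
  refine metric_ext_smooth g fun Z hZ => ?_
  have h1 := nabla_compat g hX hY hZ x
  have h2 := nabla_compat g hX (hY.const_smul c) hZ x
  have e : ip g (c • Y) Z = fun y => c * ip g Y Z y := by funext y; simp [ip]
  rw [e, dirDeriv_const_mul c ((smooth_ip g hY hZ).mdiffAt x)] at h2
  simp only [Pi.smul_apply, map_smul, smul_apply, smul_eq_mul] at h2 ⊢
  linear_combination c * h1 - h2

theorem nabla_neg (g : Metric m M) {X Y : VField m M} (hX : SmoothVField X)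
    (hY : SmoothVField Y) : nabla g X (-Y) = - nabla g X Y := by
  simpa using nabla_const_smul g (-1) hX hY

theorem nabla_zero (g : Metric m M) {X : VField m M} (hX : SmoothVField X) :
    nabla g X 0 = 0 := by
  simpa using nabla_const_smul g 0 hX hX

end LeviCivita

/-! ### Tensoriality of the Lie derivative of an endomorphism field. -/

section LieDerivative

variable {m : ℕ} {M : Type*} [TopologicalSpace M]
  [ChartedSpace (EuclideanSpace ℝ (Fin m)) M]
  [IsManifold 𝓘(ℝ, EuclideanSpace ℝ (Fin m)) ∞ M]

theorem tensorialAt_lieDeriv (Z : VField m M) {A : EndField m M} (hA : SmoothEndField A) (x : M) :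
    TensorialAt 𝓘(ℝ, EuclideanSpace ℝ (Fin m)) (EuclideanSpace ℝ (Fin m))
      (fun X : VField m M => lieDeriv Z A X x) x where
  smul := by
    intro φ X hφ hX
    have e : app A (φ • X) = φ • app A X := by funext y; simp [app]
    have b1 : bracket Z (φ • app A X) x =
        dirDeriv Z φ x • app A X x + φ x • bracket Z (app A X) x :=
      VectorField.mlieBracket_smul_right hφ (hA.mdiffAt_app hX)
    have b2 : bracket Z (φ • X) x = dirDeriv Z φ x • X x + φ x • bracket Z X x :=
      VectorField.mlieBracket_smul_right hφ hX
    simp only [lieDeriv, Pi.sub_apply, e, b1]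
    simp only [app, b2, map_add, map_smul]
    module
  add := by
    intro X Y hX hY
    have e : app A (X + Y) = app A X + app A Y := by funext y; simp [app]
    have b1 : bracket Z (app A X + app A Y) x = bracket Z (app A X) x + bracket Z (app A Y) x :=
      VectorField.mlieBracket_add_right (hA.mdiffAt_app hX) (hA.mdiffAt_app hY)
    have b2 : bracket Z (X + Y) x = bracket Z X x + bracket Z Y x :=
      VectorField.mlieBracket_add_right hX hY
    simp only [lieDeriv, Pi.sub_apply, e, b1]
    simp only [app, b2, map_add]
    module

/-- Tensoriality guarantees that `toEndField` takes its meaningful branch and not the default `0`;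
this is what gives access to `h_i`. -/
theorem toEndField_lieDeriv (Z : VField m M) {A : EndField m M} (hA : SmoothEndField A) (c : ℝ)
    {X : VField m M} (hX : SmoothVField X) :
    app (toEndField fun X => c • lieDeriv Z A X) X = c • lieDeriv Z A X := by
  funext x
  have h : ∃ L : Tan m x →L[ℝ] Tan m x, ∀ X : VField m M, SmoothVField X →
      (c • lieDeriv Z A X) x = L (X x) :=
    ⟨c • TensorialAt.mkHom _ x (tensorialAt_lieDeriv Z hA x), fun X hX => by
      rw [smul_apply, TensorialAt.mkHom_apply (tensorialAt_lieDeriv Z hA x) (hX.mdiffAt x)]; rfl⟩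
  have e : toEndField (fun X => c • lieDeriv Z A X) x = h.choose := dif_pos h
  rw [app, e, ← h.choose_spec X hX]

end LieDerivative

/-! ### Smoothness of the inverse of an endomorphism field. -/

section InverseField

variable {m : ℕ} {M : Type*} [TopologicalSpace M]
  [ChartedSpace (EuclideanSpace ℝ (Fin m)) M]
  [IsManifold 𝓘(ℝ, EuclideanSpace ℝ (Fin m)) ∞ M]

omit [IsManifold 𝓘(ℝ, EuclideanSpace ℝ (Fin m)) ∞ M] in
theorem isInvertible_of_bijective {x : M} {L : Tan m x →L[ℝ] Tan m x}
    (h : Function.Bijective L) : L.IsInvertible :=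
  ⟨(LinearEquiv.ofBijective (L : Tan m x →ₗ[ℝ] Tan m x) h).toContinuousLinearEquiv, by ext; rfl⟩

/-- The inverse of a smooth field of invertible endomorphisms is smooth. -/
theorem SmoothEndField.inverse {A : EndField m M} (hA : SmoothEndField A)
    (hb : ∀ x, Function.Bijective (A x)) : SmoothEndField (fun x => (A x).inverse) := by
  intro x₀
  have h := hA x₀
  rw [contMDiffAt_hom_bundle] at h ⊢
  refine ⟨h.1, ?_⟩
  have h2 := h.2
  set t := trivializationAt (EuclideanSpace ℝ (Fin m))
    (TangentSpace 𝓘(ℝ, EuclideanSpace ℝ (Fin m)) : M → Type _) x₀ with ht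
  have hx₀ : x₀ ∈ t.baseSet := FiberBundle.mem_baseSet_trivializationAt' x₀
  -- In a trivialization the coordinates of the inverse are the inverse of the coordinates, so the
  -- claim reduces to smoothness of inversion at an invertible operator.
  have hinv : ∀ x ∈ t.baseSet,
      ((ContinuousLinearMap.inCoordinates (EuclideanSpace ℝ (Fin m))
        (TangentSpace 𝓘(ℝ, EuclideanSpace ℝ (Fin m)) : M → Type _) (EuclideanSpace ℝ (Fin m))
        (TangentSpace 𝓘(ℝ, EuclideanSpace ℝ (Fin m)) : M → Type _) x₀ x x₀ x (A x)).IsInvertible ∧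
      (ContinuousLinearMap.inCoordinates (EuclideanSpace ℝ (Fin m))
        (TangentSpace 𝓘(ℝ, EuclideanSpace ℝ (Fin m)) : M → Type _) (EuclideanSpace ℝ (Fin m))
        (TangentSpace 𝓘(ℝ, EuclideanSpace ℝ (Fin m)) : M → Type _) x₀ x x₀ x (A x).inverse) =
      (ContinuousLinearMap.inCoordinates (EuclideanSpace ℝ (Fin m))
        (TangentSpace 𝓘(ℝ, EuclideanSpace ℝ (Fin m)) : M → Type _) (EuclideanSpace ℝ (Fin m))
        (TangentSpace 𝓘(ℝ, EuclideanSpace ℝ (Fin m)) : M → Type _) x₀ x x₀ x (A x)).inverse) := by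
    intro x hx
    obtain ⟨e, he⟩ := isInvertible_of_bijective (hb x)
    rw [ContinuousLinearMap.inCoordinates_eq hx hx, ContinuousLinearMap.inCoordinates_eq hx hx,
      ← he, ContinuousLinearMap.inverse_equiv]
    refine ⟨⟨(((t.continuousLinearEquivAt ℝ x hx).symm.trans e).trans
      (t.continuousLinearEquivAt ℝ x hx)), rfl⟩, ?_⟩
    exact (ContinuousLinearMap.inverse_equiv (((t.continuousLinearEquivAt ℝ x hx).symm.trans
      e).trans (t.continuousLinearEquivAt ℝ x hx))).symm
  have h3 := (hinv x₀ hx₀).1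
  have h4 := (ContinuousLinearMap.IsInvertible.contDiffAt_map_inverse (n := ∞) h3).contMDiffAt.comp x₀ h2
  refine h4.congr_of_eventuallyEq ?_
  filter_upwards [t.open_baseSet.mem_nhds hx₀] with x hx
  exact (hinv x hx).2

end InverseField

/-! ### Pointwise algebra of weak metric `f`-structures. -/

namespace WeakMetricFStructure

variable {n s : ℕ} {M : Type*} [TopologicalSpace M]
  [ChartedSpace (EuclideanSpace ℝ (Fin (2 * n + s))) M]
  [IsManifold 𝓘(ℝ, EuclideanSpace ℝ (Fin (2 * n + s))) ∞ M]
  (S : WeakMetricFStructure n s M)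

/-- The contact distribution `⋂ ker η^i`. -/
def contact (x : M) : Submodule ℝ (Tan (2 * n + s) x) :=
  LinearMap.ker (LinearMap.pi fun i => (S.η i x : Tan (2 * n + s) x →ₗ[ℝ] ℝ))

theorem mem_contact {x : M} {v : Tan (2 * n + s) x} :
    v ∈ S.contact x ↔ ∀ i, S.η i x v = 0 := by
  simp [contact, funext_iff]

theorem finrank_contact (x : M) : Module.finrank ℝ (S.contact x) = 2 * n := by
  have hsurj : LinearMap.range
      (LinearMap.pi fun i => (S.η i x : Tan (2 * n + s) x →ₗ[ℝ] ℝ)) = ⊤ := by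
    rw [LinearMap.range_eq_top]
    intro c
    refine ⟨∑ j, c j • S.ξ j x, funext fun i => ?_⟩
    simp [S.η_ξ]
  have := LinearMap.finrank_range_add_finrank_ker
    (LinearMap.pi fun i => (S.η i x : Tan (2 * n + s) x →ₗ[ℝ] ℝ))
  rw [hsurj, finrank_top, Module.finrank_fin_fun, finrank_tan] at this
  unfold contact
  omega

theorem eq_zero_of_f_eq_zero {x : M} {v : Tan (2 * n + s) x} (hv : v ∈ S.contact x)
    (h : S.f x v = 0) : v = 0 := by
  rw [mem_contact] at hv
  have := S.f_sq x v
  rw [h, map_zero] at this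
  simp only [hv, zero_smul, Finset.sum_const_zero, add_zero] at this
  exact (S.nonsingular_Q x).1 (by rw [map_zero]; exact neg_eq_zero.1 this.symm)

/-- On the contact distribution `f² = -Q` is injective, so the `f`-invariant contact space lies in
the range; both have dimension `2n`. -/
theorem range_f (x : M) : LinearMap.range (S.f x : Tan (2 * n + s) x →ₗ[ℝ] Tan (2 * n + s) x) =
    S.contact x := by
  have hmaps : ∀ v ∈ S.contact x, S.f x v ∈ S.contact x := fun v hv =>
    (S.mem_contact).2 (S.invariant x v ((S.mem_contact).1 hv))
  let T : S.contact x →ₗ[ℝ] S.contact x :=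
    (S.f x : Tan (2 * n + s) x →ₗ[ℝ] Tan (2 * n + s) x).restrict hmaps
  have hT : Function.Injective T := by
    rw [injective_iff_map_eq_zero]
    rintro ⟨v, hv⟩ h
    exact Subtype.ext (S.eq_zero_of_f_eq_zero hv (congrArg Subtype.val h))
  have hTs := LinearMap.injective_iff_surjective.1 hT
  symm
  refine Submodule.eq_of_le_of_finrank_eq ?_ ?_
  · intro v hv
    obtain ⟨w, hw⟩ := hTs ⟨v, hv⟩
    exact ⟨w, congrArg Subtype.val hw⟩
  · rw [S.finrank_contact]; exact (S.rank_f x).symm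

theorem η_f (i : Fin s) (x : M) (v : Tan (2 * n + s) x) : S.η i x (S.f x v) = 0 := by
  have : S.f x v ∈ S.contact x := by rw [← S.range_f]; exact ⟨v, rfl⟩
  exact S.mem_contact.1 this i

/-- `f ξ_i` is a contact vector, and `f² ξ_i = -ξ_i + ξ_i = 0`; `f` is injective on contact vectors.
-/
theorem f_ξ (i : Fin s) (x : M) : S.f x (S.ξ i x) = 0 := by
  refine S.eq_zero_of_f_eq_zero (S.mem_contact.2 fun j => S.η_f j x _) ?_
  rw [S.f_sq, S.Q_ξ]
  simp [S.η_ξ]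

/-- The projection of a vector to the contact distribution. -/
def proj (x : M) : Tan (2 * n + s) x →L[ℝ] Tan (2 * n + s) x :=
  ContinuousLinearMap.id ℝ _ - ∑ i, (S.η i x).smulRight (S.ξ i x)

theorem proj_apply (x : M) (v : Tan (2 * n + s) x) :
    S.proj x v = v - ∑ i, S.η i x v • S.ξ i x := by
  simp [proj]

theorem η_proj (i : Fin s) (x : M) (v : Tan (2 * n + s) x) : S.η i x (S.proj x v) = 0 := by
  simp [proj_apply, S.η_ξ]

theorem proj_mem (x : M) (v : Tan (2 * n + s) x) : S.proj x v ∈ S.contact x :=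
  S.mem_contact.2 fun i => S.η_proj i x v

theorem proj_of_mem {x : M} {v : Tan (2 * n + s) x} (hv : v ∈ S.contact x) : S.proj x v = v := by
  rw [mem_contact] at hv
  simp [proj_apply, hv]

theorem proj_f (x : M) (v : Tan (2 * n + s) x) : S.proj x (S.f x v) = S.f x v :=
  S.proj_of_mem (S.mem_contact.2 fun i => S.η_f i x v)

theorem exists_f_eq {x : M} {v : Tan (2 * n + s) x} (hv : v ∈ S.contact x) :
    ∃ u, S.f x u = v := by
  rw [← S.range_f] at hv
  exact hv

theorem f_f (x : M) (v : Tan (2 * n + s) x) : S.f x (S.f x v) = - S.Q x (S.proj x v) := by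
  rw [S.f_sq, S.proj_apply, map_sub, map_sum]
  simp only [map_smul, S.Q_ξ]
  abel

/-- Both sides equal `-f³ v`, computed as `f²(f v)` and as `f(f² v)`. -/
theorem f_Q (x : M) (v : Tan (2 * n + s) x) : S.f x (S.Q x v) = S.Q x (S.f x v) := by
  have h1 := S.f_f x (S.f x v)
  have h2 := congrArg (S.f x) (S.f_sq x v)
  rw [h1, S.proj_f] at h2
  simp only [map_add, map_neg, map_sum, map_smul, S.f_ξ, smul_zero, Finset.sum_const_zero,
    add_zero, neg_inj] at h2
  exact h2.symm

theorem inner_ξ (j : Fin s) (x : M) (v : Tan (2 * n + s) x) :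
    S.g.inner x v (S.ξ j x) = S.η j x v := by
  have := S.compatible x v (S.ξ j x)
  rw [S.f_ξ, map_zero, S.Q_ξ] at this
  simp [S.η_ξ] at this
  linarith

theorem ξ_inner (j : Fin s) (x : M) (v : Tan (2 * n + s) x) :
    S.g.inner x (S.ξ j x) v = S.η j x v := by rw [S.g.symm]; exact S.inner_ξ j x v

theorem Q_symm (x : M) (v w : Tan (2 * n + s) x) :
    S.g.inner x (S.Q x v) w = S.g.inner x v (S.Q x w) := by
  have h1 := S.compatible x v w
  have h2 := S.compatible x w v
  rw [S.g.symm x (S.f x w), S.g.symm x w] at h2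
  have : ∑ i, S.η i x v * S.η i x w = ∑ i, S.η i x w * S.η i x v := by
    simp only [mul_comm]
  linarith

theorem η_Q (i : Fin s) (x : M) (v : Tan (2 * n + s) x) : S.η i x (S.Q x v) = S.η i x v := by
  rw [← S.inner_ξ, S.Q_symm, S.Q_ξ, S.inner_ξ]

/-- Compatibility is applied to `v` and `f u` with `w = Q u`, which is possible since `Q` is
surjective. -/
theorem f_skew (x : M) (v w : Tan (2 * n + s) x) :
    S.g.inner x (S.f x v) w = - S.g.inner x v (S.f x w) := by
  obtain ⟨u, rfl⟩ := (S.nonsingular_Q x).2 w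
  have h := S.compatible x v (S.f x u)
  rw [S.f_sq, map_add, map_neg, map_sum] at h
  simp only [map_smul, S.inner_ξ, S.η_f, smul_zero, mul_zero, Finset.sum_const_zero, add_zero,
    sub_zero] at h
  rw [S.f_Q, ← h, neg_neg]

/-- A vector is determined by its inner products with the range of `f` and the `ξ_j`. -/
theorem ext_f_ξ {x : M} {v w : Tan (2 * n + s) x}
    (h1 : ∀ u, S.g.inner x v (S.f x u) = S.g.inner x w (S.f x u))
    (h2 : ∀ j, S.η j x v = S.η j x w) : v = w := by
  refine metric_ext S.g fun u => ?_
  obtain ⟨z, hz⟩ := S.exists_f_eq (S.proj_mem x u)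
  have : u = S.f x z + ∑ i, S.η i x u • S.ξ i x := by rw [hz, S.proj_apply]; abel
  rw [this]
  simp only [map_add, map_sum, map_smul, S.inner_ξ, h1, h2]

/-- The tensor `Q⁻¹`. -/
def Qinv : EndField (2 * n + s) M := fun x => (S.Q x).inverse

theorem Q_Qinv (x : M) (v : Tan (2 * n + s) x) : S.Q x (S.Qinv x v) = v := by
  obtain ⟨e, he⟩ := isInvertible_of_bijective (S.nonsingular_Q x)
  rw [Qinv, ← he, ContinuousLinearMap.inverse_equiv]
  simp

theorem Qinv_Q (x : M) (v : Tan (2 * n + s) x) : S.Qinv x (S.Q x v) = v :=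
  (S.nonsingular_Q x).1 (S.Q_Qinv x _)

theorem smooth_Qinv : SmoothEndField S.Qinv := S.smooth_Q.inverse S.nonsingular_Q

theorem Qinv_symm (x : M) (v w : Tan (2 * n + s) x) :
    S.g.inner x (S.Qinv x v) w = S.g.inner x v (S.Qinv x w) := by
  conv_lhs => rw [← S.Q_Qinv x w]
  rw [← S.Q_symm, S.Q_Qinv]

theorem η_Qinv (i : Fin s) (x : M) (v : Tan (2 * n + s) x) :
    S.η i x (S.Qinv x v) = S.η i x v := by
  rw [← S.η_Q, S.Q_Qinv]

theorem f_Qinv (x : M) (v : Tan (2 * n + s) x) : S.f x (S.Qinv x v) = S.Qinv x (S.f x v) := by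
  refine (S.nonsingular_Q x).1 ?_
  rw [← S.f_Q, S.Q_Qinv, S.Q_Qinv]

theorem htilde_apply (i : Fin s) (x : M) (v : Tan (2 * n + s) x) :
    S.htilde i x v = S.Qinv x (S.h i x v) := rfl

end WeakMetricFStructure

namespace WeakMetricFStructure

set_option linter.unusedSectionVars false

variable {n s : ℕ} {M : Type*} [TopologicalSpace M] [T2Space M]
  [ChartedSpace (EuclideanSpace ℝ (Fin (2 * n + s))) M]
  [IsManifold 𝓘(ℝ, EuclideanSpace ℝ (Fin (2 * n + s))) ∞ M]
  {S : WeakMetricFStructure n s M} {X Y Z : VField (2 * n + s) M}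

/-! ### Lie derivatives along the fields `ξ_i` -/

/-- This is `£_{ξ_i} η^k = 0`: indeed `dη^k(ξ_i, X) = g(ξ_i, f X) = η^i(f X) = 0`, and `η^k(ξ_i)` is
constant. -/
theorem η_bracket_ξ (hS : S.IsWeakAlmostS) (hX : SmoothVField X) (i k : Fin s) (x : M) :
    S.η k x (bracket (S.ξ i) X x) = dirDeriv (S.ξ i) (fun y => S.η k y (X y)) x := by
  have h := hS k (S.ξ i) X (S.smooth_ξ i) hX x
  have e : (fun y => S.η k y (S.ξ i y)) = fun _ => if k = i then 1 else 0 := by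
    funext y; exact S.η_ξ k i y
  simp only [dOneForm, ip, app, S.ξ_inner, S.η_f] at h
  rw [e, dirDeriv_const] at h
  linarith

/-- This is `£_{ξ_i} Φ = 0`: `Φ = dη^i`, and `£` commutes with `d` by the Jacobi identity. -/
theorem dirDeriv_ξ_Φ (hS : S.IsWeakAlmostS) (hX : SmoothVField X) (hY : SmoothVField Y)
    (i : Fin s) (x : M) :
    dirDeriv (S.ξ i) (ip S.g X (app S.f Y)) x =
      S.g.inner x (bracket (S.ξ i) X x) (S.f x (Y x)) +
        S.g.inner x (X x) (S.f x (bracket (S.ξ i) Y x)) := by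
  have hξ := S.smooth_ξ i
  have sη : ∀ {Z}, SmoothVField Z → SmoothFun _ fun y => S.η i y (Z y) := fun hZ =>
    (S.smooth_η i).apply hZ
  have e0 : ip S.g X (app S.f Y) = fun y => (1 / 2) * (dirDeriv X (fun y => S.η i y (Y y)) y -
      dirDeriv Y (fun y => S.η i y (X y)) y - S.η i y (bracket X Y y)) :=
    funext fun y => hS i X Y hX hY y
  have e1 := hS i (bracket (S.ξ i) X) Y (hξ.bracket hX) hY x
  have e2 := hS i X (bracket (S.ξ i) Y) hX (hξ.bracket hY) x
  have a : ∀ {Z}, SmoothVField Z → (fun y => S.η i y (bracket (S.ξ i) Z y)) =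
      dirDeriv (S.ξ i) (fun y => S.η i y (Z y)) := fun hZ =>
    funext fun y => η_bracket_ξ hS hZ i i y
  simp only [dOneForm, ip, app] at e1 e2
  rw [e1, e2, e0, dirDeriv_const_mul _
    (SmoothFun.mdiffAt (((SmoothFun.dirDeriv hX (sη hY)).sub (SmoothFun.dirDeriv hY (sη hX))).sub
      (sη (hX.bracket hY))) x),
    dirDeriv_sub_fun (SmoothFun.mdiffAt ((SmoothFun.dirDeriv hX (sη hY)).sub
      (SmoothFun.dirDeriv hY (sη hX))) x) ((sη (hX.bracket hY)).mdiffAt x),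
    dirDeriv_sub_fun ((SmoothFun.dirDeriv hX (sη hY)).mdiffAt x)
      ((SmoothFun.dirDeriv hY (sη hX)).mdiffAt x),
    a hX, a hY, dirDeriv_bracket hξ hX (sη hY), ← η_bracket_ξ hS (hX.bracket hY) i i x,
    congrFun (jacobi hξ hX hY) x, Pi.add_apply, map_add]
  have b := dirDeriv_bracket hξ hY (sη hX) x
  linear_combination (1 / 2) * b

/-- `£_{ξ_i} Φ = 0` and `Φ(ξ_j, ·) = 0` kill the contact part of the bracket; `£_{ξ_i} η^k = 0`
kills the rest. -/
theorem bracket_ξ_ξ (hS : S.IsWeakAlmostS) (i j : Fin s) :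
    bracket (S.ξ i) (S.ξ j) = 0 := by
  funext x
  refine S.ext_f_ξ (fun u => ?_) fun k => ?_
  · obtain ⟨Y, hY, rfl⟩ := exists_smoothVField_eq x u
    have h := dirDeriv_ξ_Φ hS (S.smooth_ξ j) hY i x
    have e : ip S.g (S.ξ j) (app S.f Y) = fun _ => 0 := by
      funext y; simp only [ip, app, S.ξ_inner, S.η_f]
    rw [e, dirDeriv_const, S.ξ_inner, S.η_f, add_zero] at h
    rw [← h]; simp
  · rw [η_bracket_ξ hS (S.smooth_ξ j)]
    have e : (fun y => S.η k y (S.ξ j y)) = fun _ => if k = j then 1 else 0 := by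
      funext y; exact S.η_ξ k j y
    rw [e, dirDeriv_const]; simp

theorem app_h (hX : SmoothVField X) (i : Fin s) :
    app (S.h i) X = (1 / 2 : ℝ) • lieDeriv (S.ξ i) S.f X :=
  toEndField_lieDeriv (S.ξ i) S.smooth_f (1 / 2) hX

theorem smooth_app_f (hX : SmoothVField X) : SmoothVField (app S.f X) := hX.app S.smooth_f

theorem smooth_app_h (hX : SmoothVField X) (i : Fin s) : SmoothVField (app (S.h i) X) := by
  rw [app_h hX]
  have hξ := S.smooth_ξ i
  exact ((hξ.bracket (smooth_app_f hX)).sub (smooth_app_f (hξ.bracket hX))).const_smul _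

theorem smooth_app_htilde (hX : SmoothVField X) (i : Fin s) :
    SmoothVField (app (S.htilde i) X) :=
  (smooth_app_h hX i).app S.smooth_Qinv

theorem bracket_ξ_f (hX : SmoothVField X) (i : Fin s) (x : M) :
    bracket (S.ξ i) (app S.f X) x =
      S.f x (bracket (S.ξ i) X x) + (2 : ℝ) • S.h i x (X x) := by
  have h := congrFun (S.app_h hX i) x
  simp only [app, lieDeriv, Pi.smul_apply, Pi.sub_apply] at h
  rw [h]
  change _ = _ + (2 : ℝ) • (1 / 2 : ℝ) • (bracket (S.ξ i) (app S.f X) x - _)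
  module

theorem bracket_ξ_Q (hQ : S.LieQVanishes) (hX : SmoothVField X) (i : Fin s) (x : M) :
    bracket (S.ξ i) (app S.Q X) x = S.Q x (bracket (S.ξ i) X x) := by
  have h := congrFun (hQ i X hX) x
  exact sub_eq_zero.1 h

theorem bracket_ξ_η_smul (hS : S.IsWeakAlmostS) (hX : SmoothVField X) (i : Fin s) (x : M) :
    bracket (S.ξ i) (∑ k, (fun y => S.η k y (X y)) • S.ξ k) x =
      ∑ k, S.η k x (bracket (S.ξ i) X x) • S.ξ k x := by
  rw [bracket_sum_right _ fun k _ => (S.smooth_ξ k).smul ((S.smooth_η k).apply hX),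
    Finset.sum_apply]
  refine Finset.sum_congr rfl fun k _ => ?_
  rw [bracket_smul_right _ ((S.smooth_η k).apply hX) (S.smooth_ξ k), bracket_ξ_ξ hS,
    η_bracket_ξ hS hX]
  simp

theorem app_f_f (X : VField (2 * n + s) M) :
    app S.f (app S.f X) = -(app S.Q X) + ∑ k, (fun y => S.η k y (X y)) • S.ξ k := by
  funext x
  simp [app, S.f_sq]

theorem smooth_sum_η_smul (hX : SmoothVField X) :
    SmoothVField (∑ k, (fun y => S.η k y (X y)) • S.ξ k) :=
  SmoothVField.sum fun k _ => (S.smooth_ξ k).smul ((S.smooth_η k).apply hX)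

/-- Leibniz rule for `£_{ξ_i}` applied to `f² = -Q + ∑ η^k ⊗ ξ_k`, whose right-hand side is
Lie-invariant. -/
theorem f_h (hS : S.IsWeakAlmostS) (hQ : S.LieQVanishes) (i : Fin s) (x : M)
    (v : Tan (2 * n + s) x) : S.f x (S.h i x v) = - S.h i x (S.f x v) := by
  obtain ⟨X, hX, rfl⟩ := exists_smoothVField_eq x v
  have h1 := bracket_ξ_f (smooth_app_f (S := S) hX) i x (S := S)
  rw [app_f_f, bracket_add_right _ (hX.app S.smooth_Q).neg (smooth_sum_η_smul hX),
    bracket_neg_right _ (hX.app S.smooth_Q), Pi.add_apply, Pi.neg_apply, bracket_ξ_Q hQ hX,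
    bracket_ξ_η_smul hS hX, bracket_ξ_f hX, map_add, map_smul, S.f_sq] at h1
  have h2 : (2 : ℝ) • (S.f x (S.h i x (X x)) + S.h i x (S.f x (X x))) = 0 := by
    have : app S.f X x = S.f x (X x) := rfl
    rw [this] at h1
    rw [smul_add]
    exact (add_left_cancel (a := -(S.Q x) (bracket (S.ξ i) X x) +
      ∑ k, S.η k x (bracket (S.ξ i) X x) • S.ξ k x) (by rw [add_zero, ← add_assoc]; exact h1)).symm
  exact eq_neg_of_add_eq_zero_left ((smul_eq_zero.1 h2).resolve_left two_ne_zero)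

theorem h_ξ (hS : S.IsWeakAlmostS) (i j : Fin s) (x : M) : S.h i x (S.ξ j x) = 0 := by
  have h := bracket_ξ_f (S.smooth_ξ j) i x (S := S)
  have e : app S.f (S.ξ j) = 0 := by funext y; exact S.f_ξ j y
  rw [e, bracket_ξ_ξ hS] at h
  have e0 : bracket (S.ξ i) 0 = 0 := VectorField.mlieBracket_zero_right
  rw [e0] at h
  simpa using h.symm

theorem η_h (hS : S.IsWeakAlmostS) (i k : Fin s) (x : M) (v : Tan (2 * n + s) x) :
    S.η k x (S.h i x v) = 0 := by
  obtain ⟨X, hX, rfl⟩ := exists_smoothVField_eq x v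
  have h := congrArg (S.η k x) (bracket_ξ_f hX i x (S := S))
  have e : (fun y => S.η k y (app S.f X y)) = fun _ => 0 := by funext y; exact S.η_f k y _
  rw [η_bracket_ξ hS (smooth_app_f hX), e, dirDeriv_const, map_add, S.η_f] at h
  simpa using h

theorem h_Q (hQ : S.LieQVanishes) (i : Fin s) (x : M) (v : Tan (2 * n + s) x) :
    S.h i x (S.Q x v) = S.Q x (S.h i x v) := by
  obtain ⟨X, hX, rfl⟩ := exists_smoothVField_eq x v
  have h1 := bracket_ξ_f (hX.app S.smooth_Q) i x (S := S)
  have e : app S.f (app S.Q X) = app S.Q (app S.f X) := by funext y; exact S.f_Q y _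
  rw [e, bracket_ξ_Q hQ (smooth_app_f hX), bracket_ξ_f hX, bracket_ξ_Q hQ hX, map_add, map_smul,
    ← S.f_Q] at h1
  exact (smul_right_injective _ (two_ne_zero (α := ℝ)) (add_left_cancel h1)).symm

/-- `(£_{ξ_i} g)(X, fY) = -2 g(X, h_i Y)`. -/
theorem lie_metric_f (hS : S.IsWeakAlmostS) (hX : SmoothVField X) (hY : SmoothVField Y)
    (i : Fin s) (x : M) :
    dirDeriv (S.ξ i) (ip S.g X (app S.f Y)) x - S.g.inner x (bracket (S.ξ i) X x) (S.f x (Y x)) -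
      S.g.inner x (X x) (bracket (S.ξ i) (app S.f Y) x) = -2 * S.g.inner x (X x) (S.h i x (Y x)) := by
  rw [dirDeriv_ξ_Φ hS hX hY, bracket_ξ_f hY, map_add, map_smul, smul_eq_mul]
  ring

/-- `£_{ξ_i} g` is symmetric, so evaluating it on `(fX, fY)` in both orders gives `g(fX, h_i Y) =
g(fY, h_i X)`; then `f` is moved across by skewness and anticommutation. Components along the `ξ_j`
do not contribute. -/
theorem h_symm (hS : S.IsWeakAlmostS) (hQ : S.LieQVanishes) (i : Fin s) (x : M)
    (v w : Tan (2 * n + s) x) :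
    S.g.inner x (S.h i x v) w = S.g.inner x v (S.h i x w) := by
  have key : ∀ v u, S.g.inner x (S.h i x v) (S.f x u) = S.g.inner x v (S.h i x (S.f x u)) := by
    intro v u
    obtain ⟨X, hX, rfl⟩ := exists_smoothVField_eq x v
    obtain ⟨Y, hY, rfl⟩ := exists_smoothVField_eq x u
    have h1 := lie_metric_f hS (smooth_app_f (S := S) hX) hY i x
    have h2 := lie_metric_f hS (smooth_app_f (S := S) hY) hX i x
    rw [ip_comm] at h2
    simp only [app] at h1 h2
    rw [S.g.symm x (bracket (S.ξ i) (app S.f Y) x),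
      S.g.symm x (S.f x (Y x)), S.g.symm x (S.f x (Y x))] at h2
    have h3 := S.f_skew x (X x) (S.h i x (Y x))
    rw [f_h hS hQ, map_neg] at h3
    linarith
  have e : S.h i x w = S.h i x (S.proj x w) := by
    rw [S.proj_apply, map_sub, map_sum]
    simp only [map_smul, h_ξ hS, smul_zero, Finset.sum_const_zero, sub_zero]
  obtain ⟨u, hu⟩ := S.exists_f_eq (S.proj_mem x w)
  rw [e, ← hu, ← key, hu, S.proj_apply, map_sub, map_sum]
  simp only [map_smul, S.inner_ξ, η_h hS, smul_zero, Finset.sum_const_zero, sub_zero]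

theorem h_Qinv (hQ : S.LieQVanishes) (i : Fin s) (x : M) (v : Tan (2 * n + s) x) :
    S.h i x (S.Qinv x v) = S.Qinv x (S.h i x v) := by
  refine (S.nonsingular_Q x).1 ?_
  rw [← h_Q hQ, S.Q_Qinv, S.Q_Qinv]

theorem htilde_symm (hS : S.IsWeakAlmostS) (hQ : S.LieQVanishes) (i : Fin s) (x : M)
    (v w : Tan (2 * n + s) x) :
    S.g.inner x (S.htilde i x v) w = S.g.inner x v (S.htilde i x w) := by
  rw [htilde_apply, htilde_apply, S.Qinv_symm, h_symm hS hQ, h_Qinv hQ]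

theorem f_htilde (hS : S.IsWeakAlmostS) (hQ : S.LieQVanishes) (i : Fin s) (x : M)
    (v : Tan (2 * n + s) x) : S.f x (S.htilde i x v) = - S.htilde i x (S.f x v) := by
  rw [htilde_apply, htilde_apply, S.f_Qinv, f_h hS hQ, map_neg]

theorem htilde_ξ (hS : S.IsWeakAlmostS) (i j : Fin s) (x : M) :
    S.htilde i x (S.ξ j x) = 0 := by
  rw [htilde_apply, h_ξ hS, map_zero]

theorem η_htilde (hS : S.IsWeakAlmostS) (i k : Fin s) (x : M) (v : Tan (2 * n + s) x) :
    S.η k x (S.htilde i x v) = 0 := by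
  rw [htilde_apply, S.η_Qinv, η_h hS]

theorem Q_htilde (i : Fin s) (x : M) (v : Tan (2 * n + s) x) :
    S.Q x (S.htilde i x v) = S.h i x v := by
  rw [htilde_apply, S.Q_Qinv]

theorem htilde_Q (hQ : S.LieQVanishes) (i : Fin s) (x : M) (v : Tan (2 * n + s) x) :
    S.htilde i x (S.Q x v) = S.Q x (S.htilde i x v) := by
  rw [Q_htilde, htilde_apply, h_Q hQ, S.Qinv_Q]

/-! ### The covariant derivative of the fields `ξ_i` -/

/-- The tensor `f + f h̃_i`. -/
def shape (S : WeakMetricFStructure n s M) (i : Fin s) : EndField (2 * n + s) M :=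
  fun x => S.f x + S.f x ∘L S.htilde i x

theorem shape_apply (i : Fin s) (x : M) (v : Tan (2 * n + s) x) :
    S.shape i x v = S.f x v + S.f x (S.htilde i x v) := rfl

theorem app_shape (i : Fin s) (X : VField (2 * n + s) M) :
    app (S.shape i) X = app S.f X + app S.f (app (S.htilde i) X) := rfl

theorem smooth_app_shape (hX : SmoothVField X) (i : Fin s) : SmoothVField (app (S.shape i) X) :=
  (smooth_app_f hX).add (smooth_app_f (smooth_app_htilde hX i))

theorem nabla_ξ (hS : S.IsWeakAlmostS) (hQ : S.LieQVanishes) (hX : SmoothVField X) (i : Fin s) :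
    nabla S.g X (S.ξ i) = -app (S.shape i) X := by
  have hξ := S.smooth_ξ i
  -- `2 g(∇_X ξ_i, Z) = 2 dη^i(X, Z) + (£_{ξ_i} g)(X, Z)`: the skew and the symmetric part of
  -- `∇ξ_i`.
  have key : ∀ Z, SmoothVField Z → ∀ x, 2 * S.g.inner x (nabla S.g X (S.ξ i) x) (Z x) =
      2 * S.g.inner x (X x) (S.f x (Z x)) + (dirDeriv (S.ξ i) (ip S.g X Z) x -
        S.g.inner x (bracket (S.ξ i) X x) (Z x) - S.g.inner x (X x) (bracket (S.ξ i) Z x)) := by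
    intro Z hZ x
    have e : ∀ W : VField (2 * n + s) M, (fun y => S.η i y (W y)) = ip S.g (S.ξ i) W := fun W =>
      funext fun y => (S.ξ_inner i y _).symm
    have h1 := hS i X Z hX hZ x
    simp only [dOneForm, e, ip, app] at h1
    rw [← S.ξ_inner] at h1
    have h2 := nabla_compat S.g hX hξ hZ x
    have h3 := nabla_compat S.g hZ hξ hX x
    have h4 := nabla_compat S.g hξ hX hZ x
    have t1 := congrFun (nabla_torsion S.g hX hZ) x
    have t2 := congrFun (nabla_torsion S.g hξ hX) x
    have t3 := congrFun (nabla_torsion S.g hξ hZ) x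
    rw [t1] at h2
    rw [t2, t3] at h4
    simp only [Pi.add_apply, map_add, add_apply] at h1 h2 h3 h4 ⊢
    rw [S.g.symm x (X x) (nabla S.g Z (S.ξ i) x)] at h4
    linarith
  funext x
  refine S.ext_f_ξ (fun u => ?_) fun j => ?_
  · obtain ⟨Y, hY, rfl⟩ := exists_smoothVField_eq x u
    have h1 := key (app S.f Y) (smooth_app_f hY) x
    rw [show app S.f Y x = S.f x (Y x) from rfl, lie_metric_f hS hX hY] at h1
    have h2 := S.f_skew x (X x) (S.f x (Y x))
    have h3 : S.g.inner x (S.f x (S.htilde i x (X x))) (S.f x (Y x)) =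
        S.g.inner x (X x) (S.h i x (Y x)) := by
      rw [S.compatible]
      simp only [η_htilde hS, zero_mul, Finset.sum_const_zero, sub_zero]
      rw [← S.Q_symm, Q_htilde, h_symm hS hQ]
    simp only [Pi.neg_apply, app, shape_apply, map_neg, map_add, add_apply, neg_apply]
    linarith
  · have h1 := key (S.ξ j) (S.smooth_ξ j) x
    have e : ip S.g X (S.ξ j) = fun y => S.η j y (X y) := funext fun y => S.inner_ξ j y _
    rw [S.f_ξ, bracket_ξ_ξ hS, S.inner_ξ, S.inner_ξ, e, η_bracket_ξ hS hX] at h1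
    simp only [Pi.neg_apply, app, shape_apply, map_neg, map_add, S.η_f]
    simp at h1
    rw [h1]; simp

end WeakMetricFStructure

namespace WeakMetricFStructure

set_option linter.unusedSectionVars false

variable {n s : ℕ} {M : Type*} [TopologicalSpace M] [T2Space M]
  [ChartedSpace (EuclideanSpace ℝ (Fin (2 * n + s))) M]
  [IsManifold 𝓘(ℝ, EuclideanSpace ℝ (Fin (2 * n + s))) ∞ M]
  {S : WeakMetricFStructure n s M} {X Y Z : VField (2 * n + s) M} {κ μ : ℝ}

/-! ### Consequences of the nullity condition -/

/-- With `A_i = f + f h̃_i` and `∇_{ξ_j} ξ_i = 0`, the curvature becomes `-A_j A_i X + (£_{ξ_j} A_i)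
X`. -/
theorem curv_ξ (hS : S.IsWeakAlmostS) (hQ : S.LieQVanishes) (hX : SmoothVField X)
    (i j : Fin s) (x : M) :
    curv S.g X (S.ξ j) (S.ξ i) x = - S.shape j x (S.shape i x (X x)) +
      bracket (S.ξ j) (app (S.shape i) X) x - S.shape i x (bracket (S.ξ j) X x) := by
  have hξ := S.smooth_ξ
  have e0 : nabla S.g (S.ξ j) (S.ξ i) = 0 := by
    rw [nabla_ξ hS hQ (hξ j)]
    funext y
    simp [app, shape_apply, S.f_ξ, htilde_ξ hS]
  have hA := smooth_app_shape (S := S) hX i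
  have e1 := nabla_torsion S.g (hξ j) hA
  rw [nabla_ξ hS hQ hA] at e1
  simp only [curv]
  rw [e0, nabla_zero S.g hX, nabla_ξ hS hQ hX, nabla_neg S.g (hξ j) hA, e1,
    nabla_ξ hS hQ (hX.bracket (hξ j)), bracket_swap X]
  simp only [Pi.sub_apply, Pi.neg_apply, Pi.add_apply, app, map_neg, Pi.zero_apply]
  simp only [← app.eq_1]
  module

/-- The tensor `£_{ξ_j} h̃_i`. -/
def lieHtilde (S : WeakMetricFStructure n s M) (j i : Fin s) (X : VField (2 * n + s) M) :
    VField (2 * n + s) M :=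
  bracket (S.ξ j) (app (S.htilde i) X) - app (S.htilde i) (bracket (S.ξ j) X)

theorem bracket_ξ_htilde (j i : Fin s) (X : VField (2 * n + s) M) (x : M) :
    bracket (S.ξ j) (app (S.htilde i) X) x =
      S.htilde i x (bracket (S.ξ j) X x) + S.lieHtilde j i X x := by
  simp only [lieHtilde, Pi.sub_apply, app]
  abel

/-- Lie derivative along `ξ_j` of the relation `h̃_i f = -f h̃_i`, with `£_{ξ_j} f = 2 h_j`. -/
theorem lieHtilde_f (hS : S.IsWeakAlmostS) (hQ : S.LieQVanishes) (hX : SmoothVField X)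
    (i j : Fin s) (x : M) :
    S.lieHtilde j i (app S.f X) x = - S.f x (S.lieHtilde j i X x) -
      (2 : ℝ) • (S.htilde i x (S.h j x (X x)) + S.h j x (S.htilde i x (X x))) := by
  have h1 := bracket_ξ_htilde (S := S) j i (app S.f X) x
  have e : app (S.htilde i) (app S.f X) = - app S.f (app (S.htilde i) X) := by
    funext y
    simp only [app, Pi.neg_apply, f_htilde hS hQ, neg_neg]
  have h2 := bracket_ξ_f (smooth_app_htilde (S := S) hX i) j x (S := S)
  rw [e, bracket_neg_right _ (smooth_app_f (smooth_app_htilde hX i)), Pi.neg_apply, h2,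
    bracket_ξ_htilde, bracket_ξ_f hX, map_add, map_add, map_smul, f_htilde hS hQ] at h1
  have e2 : app (S.htilde i) X x = S.htilde i x (X x) := rfl
  rw [e2] at h1
  rw [eq_comm, ← sub_eq_zero] at h1 ⊢
  rw [← neg_eq_zero, ← h1]
  module

theorem nullity_ξ (hS : S.IsWeakFKappaMu κ μ) (hQ : S.LieQVanishes) (hX : SmoothVField X)
    (i j : Fin s) (x : M) :
    - S.f x (S.f x (X x)) + S.h i x (X x) + S.h j x (X x) + S.h j x (S.htilde i x (X x)) +
      S.f x (S.lieHtilde j i X x) = -κ • S.f x (S.f x (X x)) + μ • S.h i x (X x) := by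
  have h1 := hS.2 i X (S.ξ j) hX (S.smooth_ξ j) x
  have hη : S.ηbar x (S.ξ j x) = 1 := by simp [ηbar, S.η_ξ]
  have ff : ∀ v, S.f x (S.f x (S.htilde j x v)) = - S.h j x v := by
    intro v
    rw [S.f_f, S.proj_of_mem (S.mem_contact.2 fun k => η_htilde hS.1 j k x v), Q_htilde]
  have ff' : ∀ v, S.f x (S.f x (S.htilde i x v)) = - S.h i x v := by
    intro v
    rw [S.f_f, S.proj_of_mem (S.mem_contact.2 fun k => η_htilde hS.1 i k x v), Q_htilde]
  rw [curv_ξ hS.1 hQ hX, S.f_ξ, map_zero, h_ξ hS.1, hη, app_shape,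
    bracket_add_right _ (smooth_app_f hX) (smooth_app_f (smooth_app_htilde hX i)), Pi.add_apply,
    bracket_ξ_f hX, bracket_ξ_f (smooth_app_htilde hX i), bracket_ξ_htilde] at h1
  have fh : ∀ v, S.htilde j x (S.f x v) = - S.f x (S.htilde j x v) := fun v => by
    rw [f_htilde hS.1 hQ, neg_neg]
  have e2 : app (S.htilde i) X x = S.htilde i x (X x) := rfl
  simp only [shape_apply, map_add, fh, ff, ff', map_neg, e2] at h1
  rw [← sub_eq_zero] at h1 ⊢
  rw [← h1]
  module

theorem h_htilde (hS : S.IsWeakFKappaMu κ μ) (hQ : S.LieQVanishes)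
    (i j : Fin s) (x : M) (v : Tan (2 * n + s) x) :
    S.htilde i x (S.htilde j x v) = (1 - κ) • S.proj x v := by
  obtain ⟨X, hX, rfl⟩ := exists_smoothVField_eq x v
  have h1 := congrArg (S.f x) (nullity_ξ hS hQ hX i j x)
  have h2 := nullity_ξ hS hQ (smooth_app_f (S := S) hX) i j x
  rw [lieHtilde_f hS.1 hQ hX] at h2
  have hf : ∀ k v, S.h k x (S.f x v) = - S.f x (S.h k x v) := fun k v => by
    rw [f_h hS.1 hQ, neg_neg]
  have hf' : ∀ k v, S.htilde k x (S.f x v) = - S.f x (S.htilde k x v) := fun k v => by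
    rw [f_htilde hS.1 hQ, neg_neg]
  simp only [map_add, map_neg, map_smul, map_sub, app, hf, hf', neg_neg] at h1 h2
  -- The sum of `f` applied to the identity at `X` and the identity at `fX`: all terms linear in
  -- `h`, hence those with `μ`, change sign and cancel, as does the Lie derivative of `h̃_i`.
  have h3 : (2 : ℝ) • S.f x ((κ - 1) • S.f x (S.f x (X x)) - S.htilde i x (S.h j x (X x))) = 0 := by
    rw [← sub_eq_zero] at h1 h2
    have := congrArg₂ (· + ·) h1 h2
    simp only [add_zero] at this
    rw [← this]
    simp only [map_sub, map_smul]
    module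
  have h4 := (smul_eq_zero.1 h3).resolve_left two_ne_zero
  have h5 := S.eq_zero_of_f_eq_zero (S.mem_contact.2 fun k => by
    simp [S.η_f, η_htilde hS.1]) h4
  apply (S.nonsingular_Q x).1
  rw [← htilde_Q hQ, Q_htilde, ← sub_eq_zero.1 h5, S.f_f, map_smul]
  module

theorem kappa_le_one (hn : 0 < n) (hs : 0 < s) [Nonempty M] (hS : S.IsWeakFKappaMu κ μ)
    (hQ : S.LieQVanishes) : κ ≤ 1 := by
  obtain ⟨x⟩ := ‹Nonempty M›
  have : Nontrivial (S.contact x) := by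
    apply Module.nontrivial_of_finrank_pos (R := ℝ)
    rw [S.finrank_contact]; omega
  obtain ⟨⟨v, hv⟩, hv0⟩ := exists_ne (0 : S.contact x)
  have hv0 : v ≠ 0 := fun h => hv0 (Subtype.ext h)
  have h1 := h_htilde hS hQ ⟨0, hs⟩ ⟨0, hs⟩ x v
  rw [S.proj_of_mem hv] at h1
  have h2 := htilde_symm hS.1 hQ ⟨0, hs⟩ x (S.htilde ⟨0, hs⟩ x v) v
  rw [h1, map_smul, smul_apply, smul_eq_mul] at h2
  have h3 := S.g.pos x v hv0
  -- By self-adjointness this quantity equals `(1 - κ) g(v, v)`.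
  have h4 : 0 ≤ S.g.inner x (S.htilde ⟨0, hs⟩ x v) (S.htilde ⟨0, hs⟩ x v) := by
    by_cases h : S.htilde ⟨0, hs⟩ x v = 0
    · rw [h, map_zero]
    · exact (S.g.pos x _ h).le
  rw [← h2] at h4
  nlinarith

theorem htilde_eq (hS : S.IsWeakFKappaMu κ μ) (hQ : S.LieQVanishes) (i j : Fin s) :
    S.htilde i = S.htilde j := by
  funext x
  ext v
  rw [← sub_eq_zero]
  refine metric_eq_zero S.g ?_
  -- All four products `h̃_a h̃_b` equal `(1 - κ) · proj`, so the square of the self-adjoint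
  -- operator `h̃_i - h̃_j` is zero.
  have e : S.g.inner x (S.htilde i x v - S.htilde j x v) (S.htilde i x v - S.htilde j x v) =
      S.g.inner x (S.htilde i x (S.htilde i x v) - S.htilde i x (S.htilde j x v) -
        (S.htilde j x (S.htilde i x v) - S.htilde j x (S.htilde j x v))) v := by
    simp only [map_sub, sub_apply, htilde_symm hS.1 hQ]
  rw [e]
  simp only [h_htilde hS hQ, sub_self, map_zero, zero_apply]

end WeakMetricFStructure

/-! ### Smooth frames of fields of subspaces. -/

section Frames

variable {m : ℕ} {M : Type*} [TopologicalSpace M]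
  [ChartedSpace (EuclideanSpace ℝ (Fin m)) M]
  [IsManifold 𝓘(ℝ, EuclideanSpace ℝ (Fin m)) ∞ M]

/-- A finite family of vectors is linearly independent iff its Gram determinant is nonzero. -/
theorem linearIndependent_iff_gram_det (g : Metric m M) {k : ℕ} {x : M} (v : Fin k → Tan m x) :
    LinearIndependent ℝ v ↔ (Matrix.of fun a b => g.inner x (v a) (v b)).det ≠ 0 := by
  have e : ∀ (c : Fin k → ℝ) (w : Tan m x),
      g.inner x w (∑ b, c b • v b) = ∑ b, g.inner x w (v b) * c b := by
    intro c w
    simp only [map_sum, map_smul, smul_eq_mul, mul_comm]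
  rw [← not_iff_not, not_not, ← Matrix.exists_mulVec_eq_zero_iff, Fintype.linearIndependent_iff]
  push Not
  refine exists_congr fun c => ?_
  rw [and_comm]
  refine and_congr (Function.ne_iff (f₁ := c) (f₂ := 0)).symm
    ⟨fun h => ?_, fun h => metric_eq_zero g ?_⟩
  · funext a
    simp only [Matrix.mulVec, dotProduct, Matrix.of_apply, Pi.zero_apply, ← e, h, map_zero]
  · rw [map_sum (g.inner x), sum_apply]
    refine Finset.sum_eq_zero fun a _ => ?_
    have := congrFun h a
    simp only [Matrix.mulVec, dotProduct, Matrix.of_apply, Pi.zero_apply, ← e] at this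
    rw [map_smul, smul_apply, this, smul_zero]

theorem isOpen_linearIndependent (g : Metric m M) {k : ℕ} {V : Fin k → VField m M}
    (hV : ∀ a, SmoothVField (V a)) : IsOpen {y | LinearIndependent ℝ fun a => V a y} := by
  have hc : Continuous fun y => (Matrix.of fun a b => ip g (V a) (V b) y).det := by
    refine Continuous.matrix_det ?_
    exact continuous_matrix fun a b => (smooth_ip g (hV a) (hV b)).continuous
  have : {y | LinearIndependent ℝ fun a => V a y} =
      (fun y => (Matrix.of fun a b => ip g (V a) (V b) y).det) ⁻¹' {0}ᶜ := by
    ext y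
    exact linearIndependent_iff_gram_det g _
  rw [this]
  exact isOpen_compl_singleton.preimage hc

/-- Through each point there are `k` smooth sections of `D` which are independent at the point. -/
def HasFrames (k : ℕ) (D : SubspaceField m M) : Prop :=
  ∀ x : M, ∃ V : Fin k → VField m M, (∀ a, SmoothVField (V a)) ∧ (∀ a y, V a y ∈ D y) ∧
    LinearIndependent ℝ fun a => V a x

omit [IsManifold 𝓘(ℝ, EuclideanSpace ℝ (Fin m)) ∞ M] in
theorem span_eq_of_linearIndependent {k : ℕ} {x : M} {D : Submodule ℝ (Tan m x)}
    (hD : Module.finrank ℝ D = k) {v : Fin k → Tan m x} (hv : ∀ a, v a ∈ D)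
    (hl : LinearIndependent ℝ v) : Submodule.span ℝ (Set.range v) = D := by
  refine Submodule.eq_of_le_of_finrank_eq (Submodule.span_le.2 ?_) ?_
  · rintro _ ⟨a, rfl⟩
    exact hv a
  · rw [finrank_span_eq_card hl, hD, Fintype.card_fin]

theorem HasFrames.isDistribution (g : Metric m M) {k : ℕ} {D : SubspaceField m M}
    (h : HasFrames k D) (hD : ∀ x, Module.finrank ℝ (D x) = k) : IsDistribution k D := by
  intro x
  obtain ⟨V, hV, hm, hl⟩ := h x
  exact ⟨_, isOpen_linearIndependent g hV, hl, V, fun a => (hV a).contMDiffOn, fun y hy =>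
    ⟨hy, span_eq_of_linearIndependent (hD y) (fun a => hm a y) hy⟩⟩

end Frames

namespace WeakMetricFStructure

set_option linter.unusedSectionVars false

variable {n s : ℕ} {M : Type*} [TopologicalSpace M] [T2Space M]
  [ChartedSpace (EuclideanSpace ℝ (Fin (2 * n + s))) M]
  [IsManifold 𝓘(ℝ, EuclideanSpace ℝ (Fin (2 * n + s))) ∞ M]
  {S : WeakMetricFStructure n s M} {X Y Z : VField (2 * n + s) M} {κ μ c : ℝ}

/-! ### The eigenspaces of `h̃_i` -/

theorem mem_eigenDist {i : Fin s} {x : M} {v : Tan (2 * n + s) x} :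
    v ∈ S.eigenDist i c x ↔ S.htilde i x v = c • v :=
  Module.End.mem_eigenspace_iff

theorem mem_contact_of_mem_eigenDist (hS : S.IsWeakAlmostS) (hc : c ≠ 0) {i : Fin s} {x : M}
    {v : Tan (2 * n + s) x} (hv : v ∈ S.eigenDist i c x) : v ∈ S.contact x := by
  refine S.mem_contact.2 fun k => ?_
  have := η_htilde hS i k x v
  rw [mem_eigenDist.1 hv, map_smul, smul_eq_mul] at this
  exact (mul_eq_zero.1 this).resolve_left hc

theorem orthogonal_eigenDist (hS : S.IsWeakAlmostS) (hQ : S.LieQVanishes) (i : Fin s) {c d : ℝ}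
    (hcd : c ≠ d) : S.Orthogonal (S.eigenDist i c) (S.eigenDist i d) := by
  intro x v hv w hw
  have := htilde_symm hS hQ i x v w
  rw [mem_eigenDist.1 hv, mem_eigenDist.1 hw, map_smul, map_smul, smul_apply, smul_eq_mul,
    smul_eq_mul] at this
  have h : (c - d) * S.g.inner x v w = 0 := by linear_combination this
  exact (mul_eq_zero.1 h).resolve_left (sub_ne_zero.2 hcd)

theorem f_mem_eigenDist (hS : S.IsWeakAlmostS) (hQ : S.LieQVanishes) {i : Fin s} {x : M}
    {v : Tan (2 * n + s) x} (hv : v ∈ S.eigenDist i c x) : S.f x v ∈ S.eigenDist i (-c) x := by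
  rw [mem_eigenDist] at hv ⊢
  rw [← neg_inj, ← f_htilde hS hQ, hv, map_smul]
  module

theorem Q_mem_eigenDist (hQ : S.LieQVanishes) {i : Fin s} {x : M}
    {v : Tan (2 * n + s) x} (hv : v ∈ S.eigenDist i c x) : S.Q x v ∈ S.eigenDist i c x := by
  rw [mem_eigenDist] at hv ⊢
  rw [htilde_Q hQ, hv, map_smul]

theorem Qinv_mem_eigenDist (hQ : S.LieQVanishes) {i : Fin s} {x : M}
    {v : Tan (2 * n + s) x} (hv : v ∈ S.eigenDist i c x) : S.Qinv x v ∈ S.eigenDist i c x := by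
  rw [mem_eigenDist] at hv ⊢
  rw [htilde_apply, h_Qinv hQ, ← htilde_apply, hv, map_smul]

/-- The projection to the eigenspace of `h̃_i` for a nonzero eigenvalue `c`. -/
def eigenProj (S : WeakMetricFStructure n s M) (i : Fin s) (c : ℝ) : EndField (2 * n + s) M :=
  fun x => (1 / 2 : ℝ) • (S.proj x + c⁻¹ • S.htilde i x)

theorem eigenProj_apply (i : Fin s) (x : M) (v : Tan (2 * n + s) x) :
    S.eigenProj i c x v = (1 / 2 : ℝ) • (S.proj x v + c⁻¹ • S.htilde i x v) := rfl

theorem smooth_app_eigenProj (hX : SmoothVField X) (i : Fin s) :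
    SmoothVField (app (S.eigenProj i c) X) := by
  have e : app (S.eigenProj i c) X = (1 / 2 : ℝ) •
      ((X - ∑ k, (fun y => S.η k y (X y)) • S.ξ k) + c⁻¹ • app (S.htilde i) X) := by
    funext y
    simp [app, eigenProj_apply, S.proj_apply]
  rw [e]
  exact ((hX.sub (smooth_sum_η_smul hX)).add ((smooth_app_htilde hX i).const_smul _)).const_smul _

/-- From `h̃² = c² proj` one gets `h̃ (proj + c⁻¹ h̃) = c (proj + c⁻¹ h̃)`. -/
theorem eigenProj_mem (hS : S.IsWeakFKappaMu κ μ) (hQ : S.LieQVanishes) (hc : c ≠ 0)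
    (hcκ : c ^ 2 = 1 - κ) (i : Fin s) (x : M) (v : Tan (2 * n + s) x) :
    S.eigenProj i c x v ∈ S.eigenDist i c x := by
  have e : S.htilde i x (S.proj x v) = S.htilde i x v := by
    rw [S.proj_apply, map_sub, map_sum]
    simp only [map_smul, htilde_ξ hS.1, smul_zero, Finset.sum_const_zero, sub_zero]
  rw [mem_eigenDist, eigenProj_apply, map_smul, map_add, map_smul, h_htilde hS hQ, e, ← hcκ]
  match_scalars <;> field_simp

theorem eigenProj_of_mem (hS : S.IsWeakAlmostS) (hc : c ≠ 0) {i : Fin s} {x : M}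
    {v : Tan (2 * n + s) x} (hv : v ∈ S.eigenDist i c x) : S.eigenProj i c x v = v := by
  rw [eigenProj_apply, S.proj_of_mem (mem_contact_of_mem_eigenDist hS hc hv), mem_eigenDist.1 hv]
  match_scalars
  field_simp
  norm_num

theorem eigenProj_add (hc : c ≠ 0) (i : Fin s) (x : M) (v : Tan (2 * n + s) x) :
    S.eigenProj i c x v + S.eigenProj i (-c) x v = S.proj x v := by
  rw [eigenProj_apply, eigenProj_apply]
  match_scalars <;> field_simp <;> norm_num

theorem ξ_mem_eigenDist (hS : S.IsWeakAlmostS) (i j : Fin s) (x : M) :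
    S.ξ j x ∈ S.eigenDist i 0 x := by
  rw [mem_eigenDist, htilde_ξ hS, zero_smul]

theorem eigenDist_sup (hS : S.IsWeakFKappaMu κ μ) (hQ : S.LieQVanishes) (hc : c ≠ 0)
    (hcκ : c ^ 2 = 1 - κ) (i : Fin s) (x : M) :
    S.eigenDist i c x ⊔ S.eigenDist i (-c) x = S.contact x := by
  apply le_antisymm
  · exact sup_le (fun v hv => mem_contact_of_mem_eigenDist hS.1 hc hv)
      fun v hv => mem_contact_of_mem_eigenDist hS.1 (neg_ne_zero.2 hc) hv
  · intro v hv
    rw [← S.proj_of_mem hv, ← eigenProj_add hc i]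
    exact Submodule.add_mem_sup (eigenProj_mem hS hQ hc hcκ i x v)
      (eigenProj_mem hS hQ (neg_ne_zero.2 hc) (by rw [neg_sq, hcκ]) i x v)

theorem eigenDist_sup_top (hS : S.IsWeakFKappaMu κ μ) (hQ : S.LieQVanishes) (hc : c ≠ 0)
    (hcκ : c ^ 2 = 1 - κ) (i : Fin s) (x : M) :
    S.eigenDist i 0 x ⊔ S.eigenDist i c x ⊔ S.eigenDist i (-c) x = ⊤ := by
  rw [sup_assoc, eigenDist_sup hS hQ hc hcκ, eq_top_iff]
  intro v _
  have : v = (∑ k, S.η k x v • S.ξ k x) + S.proj x v := by rw [S.proj_apply]; abel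
  rw [this]
  exact Submodule.add_mem_sup (Submodule.sum_mem _ fun k _ =>
    Submodule.smul_mem _ _ (ξ_mem_eigenDist hS.1 i k x)) (S.proj_mem x v)

theorem finrank_eigenDist_le (hS : S.IsWeakAlmostS) (hQ : S.LieQVanishes) (hc : c ≠ 0)
    (i : Fin s) (x : M) :
    Module.finrank ℝ (S.eigenDist i c x) ≤ Module.finrank ℝ (S.eigenDist i (-c) x) := by
  let T : S.eigenDist i c x →ₗ[ℝ] S.eigenDist i (-c) x :=
    (S.f x : Tan (2 * n + s) x →ₗ[ℝ] Tan (2 * n + s) x).restrict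
      fun v hv => f_mem_eigenDist hS hQ hv
  refine LinearMap.finrank_le_finrank_of_injective (f := T) ?_
  rw [injective_iff_map_eq_zero]
  rintro ⟨v, hv⟩ h
  exact Subtype.ext (S.eq_zero_of_f_eq_zero (mem_contact_of_mem_eigenDist hS hc hv)
    (congrArg Subtype.val h))

/-- `f` maps the eigenspaces for `c` and `-c` injectively into each other, and together they split
the contact space of dimension `2n`. -/
theorem finrank_eigenDist (hS : S.IsWeakFKappaMu κ μ) (hQ : S.LieQVanishes) (hc : c ≠ 0)
    (hcκ : c ^ 2 = 1 - κ) (i : Fin s) (x : M) : Module.finrank ℝ (S.eigenDist i c x) = n := by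
  have h1 := finrank_eigenDist_le hS.1 hQ hc i x
  have h2 := finrank_eigenDist_le hS.1 hQ (neg_ne_zero.2 hc) i x
  rw [neg_neg] at h2
  have h3 := Submodule.finrank_sup_add_finrank_inf_eq (S.eigenDist i c x) (S.eigenDist i (-c) x)
  have h4 : S.eigenDist i c x ⊓ S.eigenDist i (-c) x = ⊥ := by
    rw [eq_bot_iff]
    rintro v ⟨hv, hw⟩
    exact metric_eq_zero S.g
      (orthogonal_eigenDist hS.1 hQ i (self_ne_neg.2 hc) x v hv v hw)
  rw [h4, finrank_bot, eigenDist_sup hS hQ hc hcκ, S.finrank_contact] at h3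
  omega

theorem linearIndependent_ξ (x : M) : LinearIndependent ℝ fun i => S.ξ i x := by
  rw [Fintype.linearIndependent_iff]
  intro a h j
  have := congrArg (S.η j x) h
  simpa [S.η_ξ] using this

theorem eigenDist_zero (hS : S.IsWeakFKappaMu κ μ) (hQ : S.LieQVanishes) (hκ : κ < 1)
    (i : Fin s) (x : M) :
    S.eigenDist i 0 x = Submodule.span ℝ (Set.range fun j => S.ξ j x) := by
  apply le_antisymm
  · intro v hv
    rw [mem_eigenDist, zero_smul] at hv
    have h := h_htilde hS hQ i i x v
    rw [hv, map_zero, eq_comm] at h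
    have h2 := (smul_eq_zero.1 h).resolve_left (by linarith)
    rw [S.proj_apply, sub_eq_zero] at h2
    rw [h2]
    exact Submodule.sum_mem _ fun k _ => Submodule.smul_mem _ _ (Submodule.subset_span ⟨k, rfl⟩)
  · rw [Submodule.span_le]
    rintro _ ⟨j, rfl⟩
    exact ξ_mem_eigenDist hS.1 i j x

theorem finrank_eigenDist_zero (hS : S.IsWeakFKappaMu κ μ) (hQ : S.LieQVanishes) (hκ : κ < 1)
    (i : Fin s) (x : M) : Module.finrank ℝ (S.eigenDist i 0 x) = s := by
  rw [eigenDist_zero hS hQ hκ, finrank_span_eq_card (linearIndependent_ξ x), Fintype.card_fin]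

theorem hasFrames_eigenDist_zero (hS : S.IsWeakAlmostS) (i : Fin s) :
    HasFrames s (S.eigenDist i 0) := fun x =>
  ⟨S.ξ, S.smooth_ξ, fun j y => ξ_mem_eigenDist hS i j y, linearIndependent_ξ x⟩

/-- A basis of the eigenspace at `x` is extended to smooth fields and projected; the projection does
not change it at `x`. -/
theorem hasFrames_eigenDist (hS : S.IsWeakFKappaMu κ μ) (hQ : S.LieQVanishes) (hc : c ≠ 0)
    (hcκ : c ^ 2 = 1 - κ) (i : Fin s) : HasFrames n (S.eigenDist i c) := by
  intro x
  let b := Module.finBasisOfFinrankEq ℝ _ (finrank_eigenDist hS hQ hc hcκ i x)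
  choose X hX hXb using fun a => exists_smoothVField_eq x (b a : Tan (2 * n + s) x)
  refine ⟨fun a => app (S.eigenProj i c) (X a), fun a => smooth_app_eigenProj (hX a) i,
    fun a y => eigenProj_mem hS hQ hc hcκ i y _, ?_⟩
  have e : (fun a => app (S.eigenProj i c) (X a) x) = fun a => (b a : Tan (2 * n + s) x) := by
    funext a
    rw [app, hXb, eigenProj_of_mem hS.1 hc (b a).2]
  rw [e]
  exact b.linearIndependent.map' (S.eigenDist i c x).subtype (Submodule.ker_subtype _)

end WeakMetricFStructure

namespace WeakMetricFStructure

set_option linter.unusedSectionVars false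

variable {n s : ℕ} {M : Type*} [TopologicalSpace M] [T2Space M]
  [ChartedSpace (EuclideanSpace ℝ (Fin (2 * n + s))) M]
  [IsManifold 𝓘(ℝ, EuclideanSpace ℝ (Fin (2 * n + s))) ∞ M]
  {S : WeakMetricFStructure n s M} {X Y Z W : VField (2 * n + s) M} {κ μ c : ℝ} {i : Fin s}

/-! ### Involutivity of the eigendistributions -/

/-- Smooth sections of a field of subspaces. -/
def IsSection (D : SubspaceField (2 * n + s) M) (X : VField (2 * n + s) M) : Prop :=
  SmoothVField X ∧ ∀ x, X x ∈ D x

/-- For sections `X, Y, W` of the eigendistribution for `c`, this is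
`g((∇_X (f + f h̃)) Y, W)`, up to sign. -/
def eigenTensor (S : WeakMetricFStructure n s M) (c : ℝ) (X Y W : VField (2 * n + s) M) (x : M) :
    ℝ :=
  (1 - c) * S.g.inner x (nabla S.g X Y x) (S.f x (W x)) -
    (1 + c) * S.g.inner x (nabla S.g X W x) (S.f x (Y x))

theorem isSection_f (hS : S.IsWeakAlmostS) (hQ : S.LieQVanishes)
    (hX : IsSection (S.eigenDist i c) X) : IsSection (S.eigenDist i (-c)) (app S.f X) :=
  ⟨smooth_app_f hX.1, fun x => f_mem_eigenDist hS hQ (hX.2 x)⟩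

theorem isSection_Q (hQ : S.LieQVanishes)
    (hX : IsSection (S.eigenDist i c) X) : IsSection (S.eigenDist i c) (app S.Q X) :=
  ⟨hX.1.app S.smooth_Q, fun x => Q_mem_eigenDist hQ (hX.2 x)⟩

theorem isSection_Qinv (hQ : S.LieQVanishes)
    (hX : IsSection (S.eigenDist i c) X) : IsSection (S.eigenDist i c) (app S.Qinv X) :=
  ⟨hX.1.app S.smooth_Qinv, fun x => Qinv_mem_eigenDist hQ (hX.2 x)⟩

theorem IsSection.isHorizontal (hS : S.IsWeakAlmostS) (hc : c ≠ 0)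
    (hX : IsSection (S.eigenDist i c) X) : S.IsHorizontal X := fun k x =>
  S.mem_contact.1 (mem_contact_of_mem_eigenDist hS hc (hX.2 x)) k

theorem app_shape_of_isSection (hX : IsSection (S.eigenDist i c) X) :
    app (S.shape i) X = (1 + c) • app S.f X := by
  funext x
  simp only [app, shape_apply, mem_eigenDist.1 (hX.2 x), map_smul, Pi.smul_apply]
  module

/-- The adjoint of `f + f h̃` is `-(f + h̃ f)`, and `h̃ f w = -c f w`. -/
theorem inner_shape (hS : S.IsWeakAlmostS) (hQ : S.LieQVanishes) {x : M}
    {w : Tan (2 * n + s) x} (hw : w ∈ S.eigenDist i c x) (v : Tan (2 * n + s) x) :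
    S.g.inner x (S.shape i x v) w = -((1 - c) * S.g.inner x v (S.f x w)) := by
  have h := mem_eigenDist.1 (f_mem_eigenDist hS hQ hw)
  rw [shape_apply, map_add, add_apply, S.f_skew, S.f_skew, htilde_symm hS hQ, h, map_smul,
    smul_eq_mul]
  ring

theorem curv_of_isHorizontal (hS : S.IsWeakFKappaMu κ μ) (hX : SmoothVField X)
    (hY : SmoothVField Y) (hX' : S.IsHorizontal X) (hY' : S.IsHorizontal Y) (i : Fin s) :
    curv S.g X Y (S.ξ i) = 0 := by
  funext x
  rw [hS.2 i X Y hX hY x]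
  have h1 : S.ηbar x (X x) = 0 := by simp [ηbar, hX' _ x]
  have h2 : S.ηbar x (Y x) = 0 := by simp [ηbar, hY' _ x]
  simp [h1, h2]

/-- The Codazzi equation for `f + f h̃_i` on the eigendistributions of `h̃_i`. -/
theorem codazzi (hS : S.IsWeakFKappaMu κ μ) (hQ : S.LieQVanishes) {c d : ℝ} (hc : c ≠ 0)
    (hd : d ≠ 0) (hX : IsSection (S.eigenDist i c) X) (hY : IsSection (S.eigenDist i d) Y)
    (x : M) :
    (1 + d) • nabla S.g X (app S.f Y) x - (1 + c) • nabla S.g Y (app S.f X) x =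
      S.shape i x (nabla S.g X Y x - nabla S.g Y X x) := by
  have h := congrFun (curv_of_isHorizontal hS hX.1 hY.1 (hX.isHorizontal hS.1 hc)
    (hY.isHorizontal hS.1 hd) i) x
  have t := congrFun (nabla_torsion S.g hX.1 hY.1) x
  simp only [curv] at h
  rw [nabla_ξ hS.1 hQ hX.1, nabla_ξ hS.1 hQ hY.1, nabla_ξ hS.1 hQ (hX.1.bracket hY.1),
    nabla_neg S.g hX.1 (smooth_app_shape hY.1 i), nabla_neg S.g hY.1 (smooth_app_shape hX.1 i),
    app_shape_of_isSection hX, app_shape_of_isSection hY,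
    nabla_const_smul S.g _ hX.1 (smooth_app_f hY.1),
    nabla_const_smul S.g _ hY.1 (smooth_app_f hX.1)] at h
  have e : nabla S.g X Y x - nabla S.g Y X x = bracket X Y x := by
    rw [t, Pi.add_apply]; abel
  rw [e]
  simp only [Pi.sub_apply, Pi.neg_apply, Pi.smul_apply, Pi.zero_apply] at h
  change _ - _ - -(S.shape i x (bracket X Y x)) = 0 at h
  rw [eq_comm, ← sub_eq_zero, ← h]
  module

/-- Sections of `D(c)` and of `D(-c)` stay orthogonal under differentiation. -/
theorem inner_nabla_eq_neg (hS : S.IsWeakAlmostS) (hQ : S.LieQVanishes) (hc : c ≠ 0)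
    (hX : SmoothVField X) (hY : IsSection (S.eigenDist i (-c)) Y)
    (hW : IsSection (S.eigenDist i c) W) (x : M) :
    S.g.inner x (nabla S.g X Y x) (W x) = -S.g.inner x (nabla S.g X W x) (Y x) := by
  have h := nabla_compat S.g hX hY.1 hW.1 x
  have e : ip S.g Y W = fun _ => 0 := funext fun y =>
    orthogonal_eigenDist hS hQ i (neg_ne_self.2 hc) y _ (hY.2 y) _ (hW.2 y)
  rw [e, dirDeriv_const, S.g.symm x (Y x)] at h
  linarith

/-- The Codazzi equation for two sections of `D(c)`, paired with a third. -/
theorem eigenTensor_swap (hS : S.IsWeakFKappaMu κ μ) (hQ : S.LieQVanishes) (hc : c ≠ 0)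
    (hX : IsSection (S.eigenDist i c) X) (hY : IsSection (S.eigenDist i c) Y)
    (hW : IsSection (S.eigenDist i c) W) (x : M) :
    S.eigenTensor c X Y W x = S.eigenTensor c Y X W x := by
  have h := congrArg (fun v => S.g.inner x v (W x)) (codazzi hS hQ hc hc hX hY x)
  rw [inner_shape hS.1 hQ (hW.2 x)] at h
  simp only [map_sub, map_smul, sub_apply, smul_apply, smul_eq_mul] at h
  rw [inner_nabla_eq_neg hS.1 hQ hc hX.1 (isSection_f hS.1 hQ hY) hW,
    inner_nabla_eq_neg hS.1 hQ hc hY.1 (isSection_f hS.1 hQ hX) hW] at h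
  simp only [eigenTensor]
  simp only [app] at h
  linarith

theorem f_f_of_mem (hS : S.IsWeakAlmostS) (hc : c ≠ 0) {x : M} {v : Tan (2 * n + s) x}
    (hv : v ∈ S.eigenDist i c x) : S.f x (S.f x v) = -S.Q x v := by
  rw [S.f_f, S.proj_of_mem (mem_contact_of_mem_eigenDist hS hc hv)]

theorem nabla_Q (hN : S.NablaQVanishes) (hX : SmoothVField X) (hY : SmoothVField Y)
    (hX' : S.IsHorizontal X) (hY' : S.IsHorizontal Y) (x : M) :
    nabla S.g X (app S.Q Y) x = S.Q x (nabla S.g X Y x) :=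
  sub_eq_zero.1 (congrFun (hN X Y hX hY hX' hY') x)

/-- The Codazzi equation for `X` in `D(c)` and `fY` in `D(-c)`, paired with `fW`. The right-hand
side is a form in which skewness in `X, W` is visible. -/
theorem eigenTensor_Q (hS : S.IsWeakFKappaMu κ μ) (hQ : S.LieQVanishes) (hN : S.NablaQVanishes)
    (hc : c ≠ 0) (hX : IsSection (S.eigenDist i c) X) (hY : IsSection (S.eigenDist i c) Y)
    (hW : IsSection (S.eigenDist i c) W) (x : M) :
    S.eigenTensor c X (app S.Q Y) W x = -((1 + c) *
      (S.g.inner x (nabla S.g (app S.f Y) (app S.f X) x) (S.f x (W x)) -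
        S.g.inner x (nabla S.g (app S.f Y) X x) (S.Q x (W x)))) := by
  have hfY := isSection_f hS.1 hQ hY
  have hc' := neg_ne_zero.2 hc
  have h := congrArg (fun v => S.g.inner x v (S.f x (W x))) (codazzi hS hQ hc hc' hX hfY x)
  have e : app S.f (app S.f Y) = -app S.Q Y := by
    funext y
    simp only [app, Pi.neg_apply, f_f_of_mem hS.1 hc (hY.2 y)]
  have hhX := hX.isHorizontal hS.1 hc
  rw [inner_shape hS.1 hQ (f_mem_eigenDist hS.1 hQ (hW.2 x)), e, f_f_of_mem hS.1 hc (hW.2 x),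
    nabla_neg S.g hX.1 (hY.1.app S.smooth_Q)] at h
  simp only [Pi.neg_apply, map_sub, map_neg, map_smul, sub_apply, smul_apply, neg_apply,
    smul_eq_mul] at h
  have h2 := inner_nabla_eq_neg hS.1 hQ hc hX.1 hfY (isSection_Q hQ hW) x
  rw [nabla_Q hN hX.1 hW.1 hhX (hW.isHorizontal hS.1 hc), S.Q_symm] at h2
  simp only [app] at h h2
  simp only [eigenTensor, app]
  rw [S.f_Q]
  linear_combination -h - (1 + c) * h2

theorem eigenTensor_Q_neg (hS : S.IsWeakFKappaMu κ μ) (hQ : S.LieQVanishes)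
    (hN : S.NablaQVanishes) (hc : c ≠ 0) (hX : IsSection (S.eigenDist i c) X)
    (hY : IsSection (S.eigenDist i c) Y) (hW : IsSection (S.eigenDist i c) W) (x : M) :
    S.eigenTensor c X (app S.Q Y) W x = -S.eigenTensor c W (app S.Q Y) X x := by
  rw [eigenTensor_Q hS hQ hN hc hX hY hW, eigenTensor_Q hS hQ hN hc hW hY hX]
  have hfY := isSection_f hS.1 hQ hY
  have h1 := nabla_compat S.g hfY.1 (smooth_app_f (S := S) hX.1) (smooth_app_f (S := S) hW.1) x
  have h2 := nabla_compat S.g hfY.1 hX.1 (hW.1.app S.smooth_Q) x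
  -- Differentiating `g(fX, fW) = g(X, QW)` along `fY`, with `Q` parallel on horizontal fields,
  -- gives the skewness.
  have e : ip S.g (app S.f X) (app S.f W) = ip S.g X (app S.Q W) := by
    funext y
    simp only [ip, app, S.compatible, hX.isHorizontal hS.1 hc _ y, zero_mul,
      Finset.sum_const_zero, sub_zero]
  rw [e, h2, nabla_Q hN hfY.1 hW.1 (hfY.isHorizontal hS.1 (neg_ne_zero.2 hc))
    (hW.isHorizontal hS.1 hc), ← S.Q_symm, S.g.symm x (S.Q x (X x)),
    S.g.symm x (app S.f X x)] at h1
  simp only [app] at h1 ⊢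
  linear_combination (1 + c) * h1

theorem eigenTensor_neg (hS : S.IsWeakFKappaMu κ μ) (hQ : S.LieQVanishes)
    (hN : S.NablaQVanishes) (hc : c ≠ 0) (hX : IsSection (S.eigenDist i c) X)
    (hY : IsSection (S.eigenDist i c) Y) (hW : IsSection (S.eigenDist i c) W) (x : M) :
    S.eigenTensor c X Y W x = -S.eigenTensor c W Y X x := by
  have h := eigenTensor_Q_neg hS hQ hN hc hX (isSection_Qinv hQ hY) hW x
  have e : app S.Q (app S.Qinv Y) = Y := funext fun y => S.Q_Qinv y _
  rwa [e] at h

/-- A form symmetric in its first two slots and skew in the first and third vanishes: alternating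
the two exchanges three times returns to the start with sign `-1`. -/
theorem eigenTensor_eq_zero (hS : S.IsWeakFKappaMu κ μ) (hQ : S.LieQVanishes)
    (hN : S.NablaQVanishes) (hc : c ≠ 0) (hX : IsSection (S.eigenDist i c) X)
    (hY : IsSection (S.eigenDist i c) Y) (hW : IsSection (S.eigenDist i c) W) (x : M) :
    S.eigenTensor c X Y W x = 0 := by
  have h1 := eigenTensor_swap hS hQ hc hX hY hW x
  have h2 := eigenTensor_neg hS hQ hN hc hY hX hW x
  have h3 := eigenTensor_swap hS hQ hc hW hX hY x
  have h4 := eigenTensor_neg hS hQ hN hc hX hW hY x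
  have h5 := eigenTensor_swap hS hQ hc hY hW hX x
  have h6 := eigenTensor_neg hS hQ hN hc hW hY hX x
  linarith

theorem inner_nabla_f_eq_zero (hS : S.IsWeakFKappaMu κ μ) (hQ : S.LieQVanishes)
    (hN : S.NablaQVanishes) (hc : c ≠ 0) (hX : IsSection (S.eigenDist i c) X)
    (hY : IsSection (S.eigenDist i c) Y) (hW : IsSection (S.eigenDist i c) W) (x : M) :
    S.g.inner x (nabla S.g X Y x) (S.f x (W x)) = 0 := by
  have h1 := eigenTensor_eq_zero hS hQ hN hc hX hY hW x
  have h2 := eigenTensor_eq_zero hS hQ hN hc hX hW hY x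
  simp only [eigenTensor] at h1 h2
  -- Exchanging `Y` and `W` yields two linear equations for `g(∇_X Y, fW)` and `g(∇_X W, fY)`, with
  -- determinant `(1 - c)² - (1 + c)² = -4c`.
  have h3 : c * S.g.inner x (nabla S.g X Y x) (S.f x (W x)) = 0 := by
    linear_combination (-(1 - c) / 4) * h1 - ((1 + c) / 4) * h2
  exact (mul_eq_zero.1 h3).resolve_left hc

theorem bracket_mem_eigenDist (hS : S.IsWeakFKappaMu κ μ) (hQ : S.LieQVanishes)
    (hN : S.NablaQVanishes) (hc : c ≠ 0) (hcκ : c ^ 2 = 1 - κ)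
    (hX : IsSection (S.eigenDist i c) X) (hY : IsSection (S.eigenDist i c) Y) (x : M) :
    bracket X Y x ∈ S.eigenDist i c x := by
  have hc' := neg_ne_zero.2 hc
  have hcκ' : (-c) ^ 2 = 1 - κ := by rw [neg_sq, hcκ]
  set v := bracket X Y x with hv
  have hη : v ∈ S.contact x := by
    refine S.mem_contact.2 fun k => ?_
    have h := hS.1 k X Y hX.1 hY.1 x
    simp only [dOneForm, hX.isHorizontal hS.1 hc k, hY.isHorizontal hS.1 hc k, dirDeriv_const] at h
    have h2 := orthogonal_eigenDist hS.1 hQ i (self_ne_neg.2 hc) x _ (hX.2 x) _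
      ((isSection_f hS.1 hQ hY).2 x)
    simp only [ip] at h
    rw [h2] at h
    linarith
  have hperp : ∀ W, IsSection (S.eigenDist i c) W → S.g.inner x v (S.f x (W x)) = 0 := by
    intro W hW
    have t := congrFun (nabla_torsion S.g hX.1 hY.1) x
    have e : v = nabla S.g X Y x - nabla S.g Y X x := by rw [t, Pi.add_apply]; abel
    rw [e, map_sub, sub_apply, inner_nabla_f_eq_zero hS hQ hN hc hX hY hW,
      inner_nabla_f_eq_zero hS hQ hN hc hY hX hW, sub_zero]
  have hsplit := eigenProj_add (S := S) hc i x v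
  rw [S.proj_of_mem hη] at hsplit
  set p := S.eigenProj i c x v
  set q := S.eigenProj i (-c) x v
  have hp : p ∈ S.eigenDist i c x := eigenProj_mem hS hQ hc hcκ i x v
  have hq : q ∈ S.eigenDist i (-c) x := eigenProj_mem hS hQ hc' hcκ' i x v
  -- This vector is the preimage of `q` under `f` in `D(c)`, since `f² = -Q` there. Testing `hperp`
  -- on it gives `g(q, q) = 0`, so the `D(-c)`-component of the bracket vanishes.
  have hfq : -S.Qinv x (S.f x q) ∈ S.eigenDist i c x := by
    have := Qinv_mem_eigenDist hQ (f_mem_eigenDist hS.1 hQ hq)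
    rw [neg_neg] at this
    exact Submodule.neg_mem _ this
  obtain ⟨W, hW, hWx⟩ := exists_smoothVField_eq x (-S.Qinv x (S.f x q))
  have h := hperp (app (S.eigenProj i c) W)
    ⟨smooth_app_eigenProj hW i, fun y => eigenProj_mem hS hQ hc hcκ i y _⟩
  rw [app, hWx, eigenProj_of_mem hS.1 hc hfq, map_neg, S.f_Qinv, f_f_of_mem hS.1 hc' hq,
    map_neg (S.Qinv x), S.Qinv_Q, neg_neg, ← hsplit, map_add, add_apply,
    orthogonal_eigenDist hS.1 hQ i (self_ne_neg.2 hc) x p hp q hq, zero_add] at h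
  rw [← hsplit, metric_eq_zero S.g h, add_zero]
  exact hp

theorem bracket_mem_eigenDist_zero (hS : S.IsWeakAlmostS) (i j k : Fin s) (x : M) :
    bracket (S.ξ j) (S.ξ k) x ∈ S.eigenDist i 0 x := by
  rw [bracket_ξ_ξ hS]
  exact Submodule.zero_mem _

end WeakMetricFStructure

/-! ### The total differential equation `dφ = F ∘ φ`. -/

section TotalDifferentialEquation

open Set Metric Filter Topology

variable {E G : Type*} [NormedAddCommGroup E] [NormedSpace ℝ E]
  [NormedAddCommGroup G] [NormedSpace ℝ G]

/-- The Picard iteration acts on curves confined to the closed ball, so its fixed point also stays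
there up to time `1`; the later estimates need this confinement. -/
theorem exists_integralCurve_mem_closedBall [CompleteSpace E] {f : E → E} {x₀ : E} {a L K : NNReal}
    (hb : ∀ x ∈ closedBall x₀ a, ‖f x‖ ≤ L) (hl : LipschitzOnWith K f (closedBall x₀ a))
    (hm : L ≤ a) :
    ∃ z : ℝ → E, z 0 = x₀ ∧ (∀ t ∈ Icc (0 : ℝ) 1, z t ∈ closedBall x₀ a) ∧
      ∀ t ∈ Icc (0 : ℝ) 1, HasDerivWithinAt z (f (z t)) (Icc 0 1) t := by
  have hp : IsPicardLindelof (fun _ => f) (tmin := 0) (tmax := 1) ⟨0, by simp⟩ x₀ a 0 L K :=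
    IsPicardLindelof.of_time_independent hb hl (by simpa using hm)
  obtain ⟨α, hα⟩ := ODE.FunSpace.exists_isFixedPt_next hp (mem_closedBall_self le_rfl)
  have hmem : ∀ t, α.compProj t ∈ closedBall x₀ a := fun t =>
    α.compProj_mem_closedBall hp.mul_max_le
  refine ⟨α.compProj, ?_, fun t _ => hmem t, fun t ht => ?_⟩
  · have := ODE.FunSpace.compProj_val (α := α) (t := ⟨0, by simp⟩)
    rw [this, ← hα, ODE.FunSpace.next_apply₀]
  · apply ODE.hasDerivWithinAt_picard_Icc (t₀ := (0 : ℝ)) (u := closedBall x₀ a) (by simp)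
      hp.continuousOn_uncurry α.continuous_compProj.continuousOn (fun _ _ => hmem _) x₀ ht
      |>.congr_of_mem _ ht
    intro t' ht'
    nth_rw 1 [← hα]
    rw [ODE.FunSpace.compProj_of_mem ht', ODE.FunSpace.next_apply]

theorem gronwallBound_zero_left (K ε x : ℝ) :
    gronwallBound 0 K ε x = ε * gronwallBound 0 K 1 x := by
  unfold gronwallBound
  split_ifs <;> ring

set_option synthInstance.maxHeartbeats 200000 in
/-- Local solvability of the total differential equation `dφ = F ∘ φ` under the Frobenius
integrability condition. -/
theorem exists_hasFDerivAt_eq_comp [CompleteSpace E] {F : E → G →L[ℝ] E} {Ω : Set E}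
    (hΩ : IsOpen Ω) {x₀ : E} (hx₀ : x₀ ∈ Ω) (hF : ContDiffOn ℝ 2 F Ω)
    (hint : ∀ y ∈ Ω, ∀ u v, fderiv ℝ F y (F y u) v = fderiv ℝ F y (F y v) u) :
    ∃ r > 0, ∃ φ : G → E, φ 0 = x₀ ∧
      ∀ u ∈ ball (0 : G) r, φ u ∈ Ω ∧ HasFDerivAt φ (F (φ u)) u := by
  have hFx := hF.contDiffAt (hΩ.mem_nhds hx₀)
  have hDx : ContDiffAt ℝ 1 (fderiv ℝ F) x₀ := hFx.fderiv_right (by norm_num)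
  obtain ⟨K₂, s, hs, hK₂⟩ := hDx.exists_lipschitzOnWith
  have hb1 : ∀ᶠ y in 𝓝 x₀, ‖F y‖ < ‖F x₀‖ + 1 :=
    hFx.continuousAt.norm.eventually_lt continuousAt_const (lt_add_one _)
  have hb2 : ∀ᶠ y in 𝓝 x₀, ‖fderiv ℝ F y‖ < ‖fderiv ℝ F x₀‖ + 1 :=
    ContinuousAt.eventually_lt (f := fun y => ‖fderiv ℝ F y‖)
      (ContinuousAt.norm (E := E →L[ℝ] G →L[ℝ] E) hDx.continuousAt) continuousAt_const
      (lt_add_one _)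
  obtain ⟨R, hR, hRs⟩ := Metric.nhds_basis_closedBall.mem_iff.1
    (inter_mem (inter_mem hs (hΩ.mem_nhds hx₀)) (inter_mem hb1 hb2))
  set L : ℝ := ‖F x₀‖ + 1 with hL
  set K : ℝ := ‖fderiv ℝ F x₀‖ + 1 with hK
  have hLpos : 0 < L := by positivity
  have hKpos : 0 < K := by positivity
  have hΩR : ∀ y ∈ closedBall x₀ R, y ∈ Ω := fun y hy => (hRs hy).1.2
  have hLR : ∀ y ∈ closedBall x₀ R, ‖F y‖ ≤ L := fun y hy => le_of_lt (hRs hy).2.1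
  have hKR : ∀ y ∈ closedBall x₀ R, ‖fderiv ℝ F y‖ ≤ K := fun y hy => le_of_lt (hRs hy).2.2
  have hK₂R : LipschitzOnWith K₂ (fderiv ℝ F) (closedBall x₀ R) :=
    hK₂.mono fun y hy => (hRs hy).1.1
  have hdF : ∀ y ∈ closedBall x₀ R, HasFDerivAt F (fderiv ℝ F y) y := fun y hy =>
    ((hF.contDiffAt (hΩ.mem_nhds (hΩR y hy))).differentiableAt (by norm_num)).hasFDerivAt
  have hhalf : closedBall x₀ (R / 2) ⊆ closedBall x₀ R :=
    closedBall_subset_closedBall (by linarith)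
  have hFlip : ∀ y ∈ closedBall x₀ R, ∀ y' ∈ closedBall x₀ R, ‖F y' - F y‖ ≤ K * ‖y' - y‖ :=
    fun y hy y' hy' => (convex_closedBall x₀ R).norm_image_sub_le_of_norm_hasFDerivWithin_le
      (fun w hw => (hdF w hw).hasFDerivWithinAt) hKR hy hy'
  have hrem : ∀ y ∈ closedBall x₀ R, ∀ y' ∈ closedBall x₀ R,
      ‖F y' - F y - fderiv ℝ F y (y' - y)‖ ≤ K₂ * ‖y' - y‖ * ‖y' - y‖ := by
    intro y hy y' hy'
    have hseg : segment ℝ y y' ⊆ closedBall x₀ R := (convex_closedBall x₀ R).segment_subset hy hy'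
    refine (convex_segment y y').norm_image_sub_le_of_norm_hasFDerivWithin_le'
      (f' := fderiv ℝ F) (fun w hw => (hdF w (hseg hw)).hasFDerivWithinAt) (fun w hw => ?_)
      (left_mem_segment ℝ y y') (right_mem_segment ℝ y y')
    refine (hK₂R.norm_sub_le (hseg hw) hy).trans ?_
    gcongr
    exact norm_sub_le_of_mem_segment hw
  -- Chosen so that `L r = R / 2`: the curves stay in the half ball, and a further displacement `t
  -- F(z) v` with `‖v‖ ≤ r` stays in the full ball.
  set r : ℝ := R / (2 * L) with hr
  have hrpos : 0 < r := by positivity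
  have hLr : L * r = R / 2 := by rw [hr]; field_simp
  have hlipu : ∀ u : G, ‖u‖ ≤ r →
      LipschitzOnWith (K * r).toNNReal (fun y => F y u) (closedBall x₀ R) := by
    intro u hu
    refine LipschitzOnWith.of_dist_le_mul fun y hy y' hy' => ?_
    rw [Real.coe_toNNReal _ (by positivity), dist_eq_norm, dist_eq_norm, ← sub_apply]
    calc ‖(F y - F y') u‖ ≤ ‖F y - F y'‖ * ‖u‖ := ContinuousLinearMap.le_opNorm _ _
      _ ≤ (K * ‖y - y'‖) * r := by gcongr; exact hFlip y' hy' y hy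
      _ = K * r * ‖y - y'‖ := by ring
  -- The restriction of a solution `φ` to the ray `t ↦ t u` satisfies `z' = F(z) u`; the solution is
  -- therefore defined by `φ u = z u 1`.
  have hsol : ∀ u : G, ∃ z : ℝ → E, ‖u‖ < r → z 0 = x₀ ∧
      (∀ t ∈ Icc (0 : ℝ) 1, z t ∈ closedBall x₀ (R / 2)) ∧
      ∀ t ∈ Icc (0 : ℝ) 1, HasDerivWithinAt z (F (z t) u) (Icc 0 1) t := by
    intro u
    by_cases hu : ‖u‖ < r
    · have hR2 : ((R / 2).toNNReal : ℝ) = R / 2 := Real.coe_toNNReal _ (by positivity)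
      obtain ⟨z, h1, h2, h3⟩ := exists_integralCurve_mem_closedBall (f := fun y => F y u)
        (x₀ := x₀) (a := (R / 2).toNNReal) (L := (R / 2).toNNReal) (K := (K * r).toNNReal)
        (fun y hy => by
          rw [hR2] at hy ⊢
          calc ‖F y u‖ ≤ ‖F y‖ * ‖u‖ := ContinuousLinearMap.le_opNorm _ _
            _ ≤ L * r := by gcongr; exact hLR y (hhalf hy)
            _ = R / 2 := hLr)
        ((hlipu u hu.le).mono (by rw [hR2]; exact hhalf)) le_rfl
      rw [hR2] at h2
      exact ⟨z, fun _ => ⟨h1, h2, h3⟩⟩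
    · exact ⟨0, fun h => absurd h hu⟩
  choose z hz using hsol
  have one_mem : (1 : ℝ) ∈ Icc (0 : ℝ) 1 := by simp
  -- The first summand bounds the Taylor remainder of `F` applied to `u + v`, the second the
  -- leftover term `t DF(F v) v`.
  set C : ℝ := K₂ * L ^ 2 * r + K * L with hC
  have hest : ∀ u v : G, ‖u‖ < r → ‖u + v‖ < r → ‖v‖ ≤ r →
      ‖z (u + v) 1 - z u 1 - F (z u 1) v‖ ≤
        C * ‖v‖ ^ 2 * gronwallBound 0 (K * r).toNNReal 1 1 := by
    intro u v hu huv hv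
    obtain ⟨z0, zb, zd⟩ := hz u hu
    obtain ⟨y0, yb, yd⟩ := hz (u + v) huv
    -- First-order guess for `z (u + v)`. It solves the equation of `z (u + v)` up to an error
    -- quadratic in `v`, and Grönwall turns this into a quadratic bound at time `1`.
    set w : ℝ → E := fun t => z u t + t • F (z u t) v with hw
    set w' : ℝ → E := fun t => F (z u t) u +
      (t • fderiv ℝ F (z u t) (F (z u t) u) v + F (z u t) v) with hw'
    have hwd : ∀ t ∈ Icc (0 : ℝ) 1, HasDerivWithinAt w (w' t) (Icc 0 1) t := by
      intro t ht
      have h1 : HasDerivWithinAt (fun t => F (z u t)) (fderiv ℝ F (z u t) (F (z u t) u))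
          (Icc 0 1) t := (hdF _ (hhalf (zb t ht))).comp_hasDerivWithinAt t (zd t ht)
      have h2 : HasDerivWithinAt (fun t => F (z u t) v) (fderiv ℝ F (z u t) (F (z u t) u) v)
          (Icc 0 1) t := by
        simpa using h1.clm_apply (hasDerivWithinAt_const t (Icc 0 1) v)
      have h3 := (hasDerivWithinAt_id t (Icc (0 : ℝ) 1)).smul h2
      simp only [id, one_smul] at h3
      exact (zd t ht).add h3
    have hwz : ∀ t ∈ Icc (0 : ℝ) 1, ‖w t - z u t‖ ≤ L * ‖v‖ := by
      intro t ht
      simp only [hw, add_sub_cancel_left, norm_smul, Real.norm_eq_abs, abs_of_nonneg ht.1]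
      calc t * ‖F (z u t) v‖ ≤ 1 * (L * ‖v‖) := by
            refine mul_le_mul ht.2 ?_ (norm_nonneg _) zero_le_one
            exact (ContinuousLinearMap.le_opNorm _ _).trans
              (by gcongr; exact hLR _ (hhalf (zb t ht)))
        _ = L * ‖v‖ := one_mul _
    have hwb : ∀ t ∈ Icc (0 : ℝ) 1, w t ∈ closedBall x₀ R := by
      intro t ht
      have h1 := hwz t ht
      have h2 := zb t ht
      rw [mem_closedBall_iff_norm] at h2 ⊢
      calc ‖w t - x₀‖ ≤ ‖w t - z u t‖ + ‖z u t - x₀‖ := norm_sub_le_norm_sub_add_norm_sub _ _ _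
        _ ≤ L * r + R / 2 := by gcongr; exact h1.trans (by gcongr)
        _ = R := by rw [hLr]; ring
    have happrox : ∀ t ∈ Icc (0 : ℝ) 1, dist (w' t) (F (w t) (u + v)) ≤ C * ‖v‖ ^ 2 := by
      intro t ht
      have hzt := hhalf (zb t ht)
      -- The integrability condition enters here: `DF(F u) v` cancels against `DF(F v) u`, so no
      -- term linear in `v` survives.
      have e : w' t - F (w t) (u + v) =
          -((F (w t) - F (z u t) - fderiv ℝ F (z u t) (w t - z u t)) (u + v)) -
            t • fderiv ℝ F (z u t) (F (z u t) v) v := by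
        have hwt : w t - z u t = t • F (z u t) v := by simp [hw]
        rw [hwt]
        simp only [hw', map_smul, map_add, sub_apply, smul_apply, hint _ (hΩR _ hzt) u v]
        module
      rw [dist_eq_norm, e]
      calc _ ≤ ‖(F (w t) - F (z u t) - fderiv ℝ F (z u t) (w t - z u t)) (u + v)‖ +
            ‖t • fderiv ℝ F (z u t) (F (z u t) v) v‖ := by
              rw [← norm_neg ((F (w t) - F (z u t) - fderiv ℝ F (z u t) (w t - z u t)) (u + v))]
              exact norm_sub_le _ _
        _ ≤ (K₂ * (L * ‖v‖) * (L * ‖v‖)) * r + 1 * (K * (L * ‖v‖) * ‖v‖) := by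
              gcongr
              · refine (ContinuousLinearMap.le_opNorm _ _).trans ?_
                gcongr
                refine (hrem _ hzt _ (hwb t ht)).trans ?_
                gcongr <;> exact hwz t ht
              · rw [norm_smul, Real.norm_eq_abs, abs_of_nonneg ht.1]
                refine mul_le_mul ht.2 ?_ (norm_nonneg _) zero_le_one
                refine (ContinuousLinearMap.le_opNorm _ _).trans ?_
                gcongr
                refine (ContinuousLinearMap.le_opNorm _ _).trans ?_
                gcongr
                · exact hKR _ hzt
                · refine (ContinuousLinearMap.le_opNorm _ _).trans ?_
                  gcongr
                  exact hLR _ hzt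
        _ = C * ‖v‖ ^ 2 := by rw [hC]; ring
    have hIci : ∀ {f : ℝ → E} {f' : E} {t : ℝ}, t ∈ Ico (0 : ℝ) 1 →
        HasDerivWithinAt f f' (Icc 0 1) t → HasDerivWithinAt f f' (Ici t) t := by
      intro f f' t ht h
      refine h.mono_of_mem_nhdsWithin ?_
      exact mem_of_superset (Icc_mem_nhdsGE ht.2) (Icc_subset_Icc_left ht.1)
    have hg := dist_le_of_approx_trajectories_ODE_of_mem
      (v := fun _ y => F y (u + v)) (s := fun _ => closedBall x₀ R) (K := (K * r).toNNReal)
      (f := w) (g := z (u + v)) (f' := w') (g' := fun t => F (z (u + v) t) (u + v))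
      (a := 0) (b := 1) (εf := C * ‖v‖ ^ 2) (εg := 0) (δ := 0)
      (fun _ _ => hlipu _ huv.le) (fun t ht => (hwd t ht).continuousWithinAt)
      (fun t ht => hIci ht (hwd t (Ico_subset_Icc_self ht)))
      (fun t ht => happrox t (Ico_subset_Icc_self ht))
      (fun t ht => hwb t (Ico_subset_Icc_self ht))
      (fun t ht => (yd t ht).continuousWithinAt)
      (fun t ht => hIci ht (yd t (Ico_subset_Icc_self ht)))
      (fun t ht => by simp) (fun t ht => hhalf (yb t (Ico_subset_Icc_self ht)))
      (by simp [hw, z0, y0]) 1 one_mem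
    rw [add_zero, gronwallBound_zero_left, sub_zero, dist_comm, dist_eq_norm] at hg
    simpa [hw, sub_sub] using hg
  have hz0 : z 0 1 = x₀ := by
    obtain ⟨h0, hb, hd⟩ := hz 0 (by simpa using hrpos)
    have hc := (convex_Icc (0 : ℝ) 1).is_const_of_fderivWithin_eq_zero (𝕜 := ℝ) (f := z 0)
      (fun t ht => (hd t ht).differentiableWithinAt) (fun t ht => by
        have h1 := (hd t ht).hasFDerivWithinAt.fderivWithin
          ((uniqueDiffOn_Icc zero_lt_one) t ht)
        rw [h1]; ext; simp) one_mem (by simp : (0 : ℝ) ∈ Icc (0 : ℝ) 1)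
    rw [hc, h0]
  refine ⟨r, hrpos, fun u => z u 1, hz0, fun u hu => ?_⟩
  rw [mem_ball_zero_iff] at hu
  refine ⟨hΩR _ (hhalf ((hz u hu).2.1 1 one_mem)), ?_⟩
  rw [hasFDerivAt_iff_isLittleO_nhds_zero]
  have hO : (fun v : G => z (u + v) 1 - z u 1 - F (z u 1) v) =O[𝓝 0] fun v => ‖v‖ ^ 2 := by
    refine Asymptotics.IsBigO.of_bound (C * gronwallBound 0 (K * r).toNNReal 1 1) ?_
    have h1 : ∀ᶠ v : G in 𝓝 0, ‖u + v‖ < r :=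
      (by fun_prop : Continuous fun v : G => ‖u + v‖).continuousAt.eventually_lt
        continuousAt_const (by simpa using hu)
    have h2 : ∀ᶠ v : G in 𝓝 0, ‖v‖ < r :=
      continuous_norm.continuousAt.eventually_lt continuousAt_const (by simpa using hrpos)
    filter_upwards [h1, h2] with v h1 h2
    rw [norm_pow, norm_norm]
    exact (hest u v hu h1 h2.le).trans (by apply le_of_eq; ring)
  exact hO.trans_isLittleO (Asymptotics.isLittleO_norm_pow_id one_lt_two)

/-- Solutions of `dφ = F ∘ φ` with smooth `F` are smooth. -/
theorem contDiffOn_of_hasFDerivAt_eq_comp {F : E → G →L[ℝ] E} {Ω : Set E} {U : Set G}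
    (hU : IsOpen U) (hF : ContDiffOn ℝ ∞ F Ω) {φ : G → E}
    (hφ : ∀ u ∈ U, φ u ∈ Ω ∧ HasFDerivAt φ (F (φ u)) u) : ContDiffOn ℝ ∞ φ U := by
  rw [contDiffOn_infty]
  intro k
  -- Bootstrap: if `φ` is `C^k`, so is `dφ = F ∘ φ`, hence `φ` is `C^(k+1)`.
  induction k with
  | zero => exact contDiffOn_zero.2 fun u hu => (hφ u hu).2.continuousAt.continuousWithinAt
  | succ k ih =>
    push_cast
    rw [contDiffOn_succ_iff_fderiv_of_isOpen hU]
    refine ⟨fun u hu => (hφ u hu).2.differentiableAt.differentiableWithinAt, by simp, ?_⟩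
    refine (((hF.of_le (mod_cast le_top)).comp ih fun u hu => (hφ u hu).1)).congr fun u hu => ?_
    exact (hφ u hu).2.fderiv

end TotalDifferentialEquation

/-! ### The Frobenius theorem in a vector space. -/

section Frobenius

open Set Metric Filter Topology

variable {E : Type*} [NormedAddCommGroup E] [NormedSpace ℝ E] {k : ℕ}

/-- The linear map `u ↦ ∑ u_a v_a`. -/
def linComb (v : Fin k → E) : EuclideanSpace ℝ (Fin k) →L[ℝ] E :=
  ∑ a, (EuclideanSpace.proj (𝕜 := ℝ) a).smulRight (v a)

theorem linComb_apply (v : Fin k → E) (u : EuclideanSpace ℝ (Fin k)) :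
    linComb v u = ∑ a, u a • v a := by
  simp [linComb]

theorem range_linComb (v : Fin k → E) :
    (linComb v : EuclideanSpace ℝ (Fin k) →ₗ[ℝ] E).range = Submodule.span ℝ (range v) := by
  ext w
  rw [LinearMap.mem_range, Submodule.mem_span_range_iff_exists_fun]
  constructor
  · rintro ⟨u, rfl⟩
    exact ⟨u, (linComb_apply v u).symm⟩
  · rintro ⟨c, rfl⟩
    exact ⟨WithLp.toLp 2 c, linComb_apply v _⟩

theorem linComb_injective {v : Fin k → E} (hv : LinearIndependent ℝ v) :
    Function.Injective (linComb v) := by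
  rw [injective_iff_map_eq_zero]
  intro u hu
  rw [linComb_apply] at hu
  ext a
  exact Fintype.linearIndependent_iff.1 hv u hu a

theorem contDiffOn_linComb {V : Fin k → E → E} {Ω : Set E} {N : WithTop ℕ∞}
    (hV : ∀ a, ContDiffOn ℝ N (V a) Ω) : ContDiffOn ℝ N (fun y => linComb fun a => V a y) Ω := by
  unfold linComb
  exact ContDiffOn.sum fun a _ => contDiffOn_const.smulRight (hV a)

theorem fderiv_linComb {V : Fin k → E → E} {y : E} (hV : ∀ a, DifferentiableAt ℝ (V a) y)
    (w : E) (u : EuclideanSpace ℝ (Fin k)) :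
    fderiv ℝ (fun y => linComb fun a => V a y) y w u = ∑ a, u a • fderiv ℝ (V a) y w := by
  have h : HasFDerivAt (fun y => linComb (fun a => V a y) u) (∑ a, u a • fderiv ℝ (V a) y) y := by
    simp only [linComb_apply]
    exact HasFDerivAt.fun_sum fun a _ => (hV a).hasFDerivAt.const_smul (u a)
  have hd : DifferentiableAt ℝ (fun y => linComb fun a => V a y) y := by
    unfold linComb
    exact DifferentiableAt.fun_sum fun a _ => (ContinuousLinearMap.smulRightL ℝ _ E
      (EuclideanSpace.proj (𝕜 := ℝ) a)).differentiableAt.comp y (hV a)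
  have h' := hd.hasFDerivAt.clm_apply (hasFDerivAt_const u y)
  have := congrArg (fun A => A w) (h.unique h')
  simpa using this.symm

set_option synthInstance.maxHeartbeats 200000 in
-- The frame is renormalised to `F = A (p A)⁻¹`, so that `p F = id` for a fixed `p`. The defect
-- `DF(F u) v - DF(F v) u` lies in `ker p` because `p F` is constant, and in the range of `F` by
-- involutivity; these meet only in `0`.
theorem exists_contDiffOn_range_eq_span [FiniteDimensional ℝ E] {V : Fin k → E → E} {Ω : Set E}
    (hΩ : IsOpen Ω) {x₀ : E} (hx₀ : x₀ ∈ Ω) (hV : ∀ a, ContDiffOn ℝ ∞ (V a) Ω)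
    (hl : LinearIndependent ℝ fun a => V a x₀)
    (hb : ∀ y ∈ Ω, ∀ a b, VectorField.lieBracket ℝ (V a) (V b) y ∈
      Submodule.span ℝ (range fun a => V a y)) :
    ∃ (Ω' : Set E) (F : E → EuclideanSpace ℝ (Fin k) →L[ℝ] E)
      (p : E →L[ℝ] EuclideanSpace ℝ (Fin k)), IsOpen Ω' ∧ x₀ ∈ Ω' ∧ Ω' ⊆ Ω ∧
      ContDiffOn ℝ ∞ F Ω' ∧ ∀ y ∈ Ω', (∀ u, p (F y u) = u) ∧
        (F y).range = Submodule.span ℝ (range fun a => V a y) ∧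
        ∀ u v, fderiv ℝ F y (F y u) v = fderiv ℝ F y (F y v) u := by
  set A : E → EuclideanSpace ℝ (Fin k) →L[ℝ] E := fun y => linComb fun a => V a y with hA
  have hAs : ContDiffOn ℝ ∞ A Ω := contDiffOn_linComb hV
  obtain ⟨p₀, hp₀⟩ := LinearMap.exists_leftInverse_of_injective
    (A x₀ : EuclideanSpace ℝ (Fin k) →ₗ[ℝ] E) (LinearMap.ker_eq_bot.2 (linComb_injective hl))
  set p : E →L[ℝ] EuclideanSpace ℝ (Fin k) := LinearMap.toContinuousLinearMap p₀ with hp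
  set P : E → EuclideanSpace ℝ (Fin k) →L[ℝ] EuclideanSpace ℝ (Fin k) := fun y => p ∘L A y with hP
  have hPs : ContDiffOn ℝ ∞ P Ω := contDiffOn_const.clm_comp hAs
  set Ω' : Set E := Ω ∩ P ⁻¹' (range ((↑) :
    (EuclideanSpace ℝ (Fin k) ≃L[ℝ] EuclideanSpace ℝ (Fin k)) → _)) with hΩ'
  have hΩ'o : IsOpen Ω' :=
    hPs.continuousOn.isOpen_inter_preimage hΩ (ContinuousLinearEquiv.isOpen)
  have hinv : ∀ y ∈ Ω', (P y).IsInvertible := fun y hy => hy.2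
  set F : E → EuclideanSpace ℝ (Fin k) →L[ℝ] E := fun y => A y ∘L (P y).inverse with hF
  have hFs : ContDiffOn ℝ ∞ F Ω' := by
    refine (hAs.mono inter_subset_left).clm_comp fun y hy => ?_
    exact ContDiffAt.comp_contDiffWithinAt y (hinv y hy).contDiffAt_map_inverse
      ((hPs.mono inter_subset_left) y hy)
  have hpF : ∀ y ∈ Ω', ∀ u, p (F y u) = u := fun y hy u => (hinv y hy).self_apply_inverse u
  have hFP : ∀ y ∈ Ω', F y ∘L P y = A y := by
    intro y hy
    ext1 u
    simp only [hF, ContinuousLinearMap.comp_apply]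
    rw [(hinv y hy).inverse_apply_self]
  have hrange : ∀ y ∈ Ω', (F y).range = Submodule.span ℝ (range fun a => V a y) := by
    intro y hy
    rw [← range_linComb]
    ext w
    constructor
    · rintro ⟨u, rfl⟩
      exact ⟨(P y).inverse u, rfl⟩
    · rintro ⟨u, rfl⟩
      exact ⟨P y u, congrArg (fun B => B u) (hFP y hy)⟩
  refine ⟨Ω', F, p, hΩ'o, ⟨hx₀, ?_⟩, inter_subset_left, hFs,
    fun y hy => ⟨hpF y hy, hrange y hy, ?_⟩⟩
  · refine ⟨ContinuousLinearEquiv.refl ℝ _, ?_⟩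
    ext1 u
    exact (congrArg (fun B => B u) hp₀).symm
  intro u v
  have hnhds : Ω' ∈ 𝓝 y := hΩ'o.mem_nhds hy
  have hFd : DifferentiableAt ℝ F y := (hFs.contDiffAt hnhds).differentiableAt (by simp)
  have hPd : DifferentiableAt ℝ P y :=
    (hPs.contDiffAt (hΩ.mem_nhds hy.1)).differentiableAt (by simp)
  have hVd : ∀ a, DifferentiableAt ℝ (V a) y := fun a =>
    ((hV a).contDiffAt (hΩ.mem_nhds hy.1)).differentiableAt (by simp)
  have hpD : ∀ w v, p (fderiv ℝ F y w v) = 0 := by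
    intro w v
    have h1 := p.hasFDerivAt.comp y (hFd.hasFDerivAt.clm_apply (hasFDerivAt_const v y))
    have h2 : HasFDerivAt (fun z => p (F z v)) (0 : E →L[ℝ] EuclideanSpace ℝ (Fin k)) y :=
      (hasFDerivAt_const v y).congr_of_eventuallyEq
        (Filter.eventually_of_mem hnhds fun z hz => hpF z hz v)
    have := congrArg (fun B => B w) (h1.unique h2)
    simpa using this
  have hFA : ∀ w v, fderiv ℝ F y w (P y v) + F y (fderiv ℝ P y w v) =
      ∑ a, v a • fderiv ℝ (V a) y w := by
    intro w v
    rw [← fderiv_linComb hVd]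
    have h1 := hFd.hasFDerivAt.clm_comp hPd.hasFDerivAt
    have h2 : fderiv ℝ (fun z => F z ∘L P z) y = fderiv ℝ A y :=
      Filter.EventuallyEq.fderiv_eq (Filter.eventually_of_mem hnhds fun z hz => hFP z hz)
    rw [h1.fderiv] at h2
    have := congrArg (fun B => B w v) h2
    simp at this
    rw [← this]
    abel
  have hmem : fderiv ℝ F y (F y u) v - fderiv ℝ F y (F y v) u ∈ (F y).range := by
    obtain ⟨u', rfl⟩ : ∃ u', P y u' = u := ⟨_, (hinv y hy).self_apply_inverse u⟩
    obtain ⟨v', rfl⟩ : ∃ v', P y v' = v := ⟨_, (hinv y hy).self_apply_inverse v⟩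
    have e1 : ∀ u', F y (P y u') = ∑ a, u' a • V a y := fun u' => by
      rw [← linComb_apply]
      exact congrArg (fun B => B u') (hFP y hy)
    -- Differentiating `F P = A` expresses the defect, up to vectors in the range of `F`, by
    -- brackets of the frame.
    have e2 : fderiv ℝ F y (F y (P y u')) (P y v') - fderiv ℝ F y (F y (P y v')) (P y u') =
        (∑ a, ∑ b, (u' a * v' b) • VectorField.lieBracket ℝ (V a) (V b) y)
        - F y (fderiv ℝ P y (F y (P y u')) v') + F y (fderiv ℝ P y (F y (P y v')) u') := by
      rw [← sub_eq_zero]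
      have := hFA (F y (P y u')) v'
      have h' := hFA (F y (P y v')) u'
      rw [← eq_sub_iff_add_eq] at this h'
      rw [this, h', e1, e1]
      simp only [VectorField.lieBracket, map_sum, map_smul, smul_sub, Finset.sum_sub_distrib,
        Finset.smul_sum, smul_smul]
      rw [Finset.sum_comm]
      simp only [mul_comm]
      abel
    rw [e2]
    refine add_mem (sub_mem ?_ ⟨_, rfl⟩) ⟨_, rfl⟩
    rw [hrange y hy]
    exact Submodule.sum_mem _ fun a _ => Submodule.sum_mem _ fun b _ =>
      Submodule.smul_mem _ _ (hb y hy.1 a b)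
  obtain ⟨t, ht⟩ := hmem
  have ht' : F y t = fderiv ℝ F y (F y u) v - fderiv ℝ F y (F y v) u := ht
  have : t = 0 := by rw [← hpF y hy t, ht', map_sub, hpD, hpD, sub_zero]
  rw [← sub_eq_zero, ← ht', this, map_zero]

set_option synthInstance.maxHeartbeats 200000 in
/-- The Frobenius theorem in a vector space. -/
theorem exists_integralManifold [FiniteDimensional ℝ E] {V : Fin k → E → E} {Ω : Set E}
    (hΩ : IsOpen Ω) {x₀ : E} (hx₀ : x₀ ∈ Ω) (hV : ∀ a, ContDiffOn ℝ ∞ (V a) Ω)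
    (hl : LinearIndependent ℝ fun a => V a x₀)
    (hb : ∀ y ∈ Ω, ∀ a b, VectorField.lieBracket ℝ (V a) (V b) y ∈
      Submodule.span ℝ (range fun a => V a y)) :
    ∃ (U : Set (EuclideanSpace ℝ (Fin k))) (φ : EuclideanSpace ℝ (Fin k) → E),
      IsOpen U ∧ 0 ∈ U ∧ φ 0 = x₀ ∧ InjOn φ U ∧ ContDiffOn ℝ ∞ φ U ∧
      ∀ u ∈ U, φ u ∈ Ω ∧ ∃ A : EuclideanSpace ℝ (Fin k) →L[ℝ] E, HasFDerivAt φ A u ∧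
        Function.Injective A ∧ A.range = Submodule.span ℝ (range fun a => V a (φ u)) := by
  obtain ⟨Ω', F, p, hΩ', hx, hsub, hF, h⟩ := exists_contDiffOn_range_eq_span hΩ hx₀ hV hl hb
  have : CompleteSpace E := FiniteDimensional.complete ℝ E
  obtain ⟨r, hr, φ, hφ0, hφ⟩ := exists_hasFDerivAt_eq_comp hΩ' hx
    (hF.of_le (WithTop.coe_le_coe.2 le_top)) fun y hy => (h y hy).2.2
  refine ⟨ball 0 r, φ, isOpen_ball, mem_ball_self hr, hφ0, ?_,
    contDiffOn_of_hasFDerivAt_eq_comp isOpen_ball hF hφ, fun u hu => ⟨hsub (hφ u hu).1, F (φ u),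
      (hφ u hu).2, Function.LeftInverse.injective (h _ (hφ u hu).1).1, (h _ (hφ u hu).1).2.1⟩⟩
  -- Since `p F = id`, the map `p ∘ φ - id` has zero derivative on a ball, hence is constant; so `φ`
  -- is injective.
  have hd : ∀ u ∈ ball (0 : EuclideanSpace ℝ (Fin k)) r,
      HasFDerivWithinAt (fun u => p (φ u) - u) (0 : EuclideanSpace ℝ (Fin k) →L[ℝ] _) (ball 0 r) u := by
    intro u hu
    have := ((p.hasFDerivAt.comp u (hφ u hu).2).sub (hasFDerivAt_id u)).hasFDerivWithinAt (s := ball 0 r)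
    refine this.congr_fderiv ?_
    ext1 v
    simp [(h _ (hφ u hu).1).1]
  intro u hu v hv huv
  have := (convex_ball (0 : EuclideanSpace ℝ (Fin k)) r).is_const_of_fderivWithin_eq_zero (𝕜 := ℝ)
    (fun u hu => (hd u hu).differentiableWithinAt)
    (fun u hu => (hd u hu).fderivWithin (isOpen_ball.uniqueDiffWithinAt hu)) hu hv
  simpa [huv] using this

end Frobenius

/-! ### The Frobenius theorem on manifolds, through charts. -/

section Integrability

open Set Filter Topology

variable {m : ℕ} {M : Type*} [TopologicalSpace M]
  [ChartedSpace (EuclideanSpace ℝ (Fin m)) M]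
  [IsManifold 𝓘(ℝ, EuclideanSpace ℝ (Fin m)) ∞ M]

local notation "J" => 𝓘(ℝ, EuclideanSpace ℝ (Fin m))

/-- The representation of a vector field in the preferred chart at `x`. -/
def chartVField (x : M) (X : VField m M) (y : EuclideanSpace ℝ (Fin m)) :
    EuclideanSpace ℝ (Fin m) :=
  VectorField.mpullback J J (extChartAt J x).symm X y

theorem contMDiffAt_extChartAt_symm' {x : M} {y : EuclideanSpace ℝ (Fin m)}
    (hy : y ∈ (extChartAt J x).target) : ContMDiffAt J J ∞ (extChartAt J x).symm y :=
  (contMDiffOn_extChartAt_symm x).contMDiffAt ((isOpen_extChartAt_target x).mem_nhds hy)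

theorem isInvertible_mfderiv_extChartAt_symm {x : M} {y : EuclideanSpace ℝ (Fin m)}
    (hy : y ∈ (extChartAt J x).target) : (mfderiv J J (extChartAt J x).symm y).IsInvertible := by
  have := isInvertible_mfderivWithin_extChartAt_symm (I := J) hy
  rwa [ModelWithCorners.range_eq_univ, mfderivWithin_univ] at this

/-- The derivative of the inverse of the preferred chart at `x`. -/
def chartSymmDeriv (x : M) (y : EuclideanSpace ℝ (Fin m)) :
    EuclideanSpace ℝ (Fin m) →L[ℝ] Tan m ((extChartAt J x).symm y) :=
  mfderiv J J (extChartAt J x).symm y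

theorem chartSymmDeriv_chartVField {x : M} {y : EuclideanSpace ℝ (Fin m)}
    (hy : y ∈ (extChartAt J x).target) (X : VField m M) :
    chartSymmDeriv x y (chartVField x X y) = X ((extChartAt J x).symm y) :=
  (isInvertible_mfderiv_extChartAt_symm hy).self_apply_inverse _

theorem SmoothVField.contDiffOn_chartVField {X : VField m M} (hX : SmoothVField X) (x : M) :
    ContDiffOn ℝ ∞ (chartVField x X) (extChartAt J x).target := by
  intro y hy
  refine ContDiffAt.contDiffWithinAt ?_
  refine contMDiffAt_vectorSpace_iff_contDiffAt.1 ?_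
  exact ContMDiffAt.mpullback_vectorField_preimage (n := ∞) (hX _)
    (contMDiffAt_extChartAt_symm' hy) (isInvertible_mfderiv_extChartAt_symm hy) (by simp)

theorem chartVField_bracket {X Y : VField m M} (hX : SmoothVField X) (hY : SmoothVField Y)
    {x : M} {y : EuclideanSpace ℝ (Fin m)} (hy : y ∈ (extChartAt J x).target) :
    chartVField x (bracket X Y) y =
      VectorField.lieBracket ℝ (chartVField x X) (chartVField x Y) y := by
  have := VectorField.mpullback_mlieBracket (n := ∞) (hX.mdiffAt _) (hY.mdiffAt _)
    (contMDiffAt_extChartAt_symm' hy)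
    (by rw [minSmoothness_of_isRCLikeNormedField]; exact WithTop.coe_le_coe.2 le_top)
  refine this.trans ?_
  have h := VectorField.mlieBracketWithin_eq_lieBracketWithin (𝕜 := ℝ) (s := univ)
    (V := chartVField x X) (W := chartVField x Y)
  exact congrFun ((VectorField.mlieBracketWithin_univ (I := J)).symm.trans
    (h.trans VectorField.lieBracketWithin_univ)) y

theorem map_span_chartVField {k : ℕ} {x : M} {y : EuclideanSpace ℝ (Fin m)}
    (hy : y ∈ (extChartAt J x).target) (V : Fin k → VField m M) :
    (Submodule.span ℝ (range fun a => chartVField x (V a) y)).map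
        (chartSymmDeriv x y : EuclideanSpace ℝ (Fin m) →ₗ[ℝ] Tan m ((extChartAt J x).symm y)) =
      Submodule.span ℝ (range fun a => V a ((extChartAt J x).symm y)) := by
  rw [Submodule.map_span, ← range_comp]
  congr 2
  funext a
  exact chartSymmDeriv_chartVField hy (V a)

/-- `D` is spanned near each point by `k` smooth independent vector fields whose brackets are
sections of `D`. -/
def HasInvolutiveFrames (k : ℕ) (D : SubspaceField m M) : Prop :=
  ∀ x : M, ∃ V : Fin k → VField m M, (∀ a, SmoothVField (V a)) ∧ (∀ a y, V a y ∈ D y) ∧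
    (LinearIndependent ℝ fun a => V a x) ∧ ∀ a b y, bracket (V a) (V b) y ∈ D y

/-- The Frobenius theorem. -/
theorem HasInvolutiveFrames.isIntegrable (g : Metric m M) {k : ℕ} {D : SubspaceField m M}
    (h : HasInvolutiveFrames k D) (hD : ∀ x, Module.finrank ℝ (D x) = k) : IsIntegrable k D := by
  intro x
  obtain ⟨V, hV, hm, hl, hb⟩ := h x
  set e := extChartAt J x with he
  -- The part of the chart where the frame stays independent and so, by the rank, spans `D`.
  set Ω : Set (EuclideanSpace ℝ (Fin m)) :=
    e.target ∩ e.symm ⁻¹' {y | LinearIndependent ℝ fun a => V a y} with hΩ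
  have hΩo : IsOpen Ω := (continuousOn_extChartAt_symm x).isOpen_inter_preimage
    (isOpen_extChartAt_target x) (isOpen_linearIndependent g hV)
  have hx : e.symm (e x) = x := extChartAt_to_inv x
  have hx₀ : e x ∈ Ω := ⟨mem_extChartAt_target x, by
    change LinearIndependent ℝ fun a => V a (e.symm (e x))
    rw [hx]
    exact hl⟩
  have hspan : ∀ y ∈ Ω, Submodule.span ℝ (range fun a => V a (e.symm y)) = D (e.symm y) :=
    fun y hy => span_eq_of_linearIndependent (hD _) (fun a => hm a _) hy.2
  have hmap : ∀ y ∈ Ω, (Submodule.span ℝ (range fun a => chartVField x (V a) y)).map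
      (chartSymmDeriv x y : EuclideanSpace ℝ (Fin m) →ₗ[ℝ] Tan m (e.symm y)) = D (e.symm y) :=
    fun y hy => (map_span_chartVField hy.1 V).trans (hspan y hy)
  have hinj : ∀ y ∈ Ω, Function.Injective (chartSymmDeriv x y) := fun y hy =>
    (isInvertible_mfderiv_extChartAt_symm hy.1).injective
  have hl' : LinearIndependent ℝ fun a => chartVField x (V a) (e x) := by
    have : LinearIndependent ℝ fun a => V a (e.symm (e x)) := hx₀.2
    refine LinearIndependent.of_comp
      (chartSymmDeriv x (e x) : EuclideanSpace ℝ (Fin m) →ₗ[ℝ] Tan m (e.symm (e x))) ?_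
    convert this using 1
    funext a
    exact chartSymmDeriv_chartVField hx₀.1 (V a)
  -- Brackets are natural under the chart, and injectivity of its inverse's derivative pulls
  -- membership in `D` back to the span.
  have hb' : ∀ y ∈ Ω, ∀ a b, VectorField.lieBracket ℝ (chartVField x (V a)) (chartVField x (V b)) y
      ∈ Submodule.span ℝ (range fun a => chartVField x (V a) y) := by
    intro y hy a b
    rw [← chartVField_bracket (hV a) (hV b) hy.1]
    have h1 := hb a b (e.symm y)
    rw [← chartSymmDeriv_chartVField hy.1 (bracket (V a) (V b)), ← hmap y hy] at h1
    obtain ⟨w, hw, hw'⟩ := h1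
    rwa [← hinj y hy hw']
  obtain ⟨U, φ, hU, h0, hφ0, hφi, hφs, hφ⟩ := exists_integralManifold hΩo hx₀
    (fun a => ((hV a).contDiffOn_chartVField x).mono inter_subset_left) hl' hb'
  refine ⟨U, fun u => e.symm (φ u), hU, h0, ?_, ?_, ?_, fun u hu => ?_⟩
  · simp only [hφ0, hx]
  · intro u hu v hv huv
    exact hφi hu hv (e.symm.injOn (hφ u hu).1.1 (hφ v hv).1.1 huv)
  · exact (contMDiffOn_extChartAt_symm x).comp hφs.contMDiffOn fun u hu => (hφ u hu).1.1
  · obtain ⟨hy, A, hA, hAi, hAr⟩ := hφ u hu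
    have hd : mfderiv 𝓘(ℝ, EuclideanSpace ℝ (Fin k)) J (fun u => e.symm (φ u)) u =
        (chartSymmDeriv x (φ u)).comp A :=
      (((contMDiffAt_extChartAt_symm' hy.1).mdifferentiableAt (by simp)).hasMFDerivAt.comp u
        hA.hasMFDerivAt).mfderiv
    rw [hd]
    refine ⟨(hinj _ hy).comp hAi, ?_⟩
    rw [← hmap _ hy, ← hAr]
    exact LinearMap.range_comp (A : EuclideanSpace ℝ (Fin k) →ₗ[ℝ] EuclideanSpace ℝ (Fin m))
      (chartSymmDeriv x (φ u) : EuclideanSpace ℝ (Fin m) →ₗ[ℝ] Tan m (e.symm (φ u)))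

end Integrability

/-! ### Involutive frames of the eigendistributions and the main theorem. -/

namespace WeakMetricFStructure

variable {n s : ℕ} {M : Type*} [TopologicalSpace M] [T2Space M]
  [ChartedSpace (EuclideanSpace ℝ (Fin (2 * n + s))) M]
  [IsManifold 𝓘(ℝ, EuclideanSpace ℝ (Fin (2 * n + s))) ∞ M]
  {S : WeakMetricFStructure n s M} {κ μ c : ℝ}

theorem hasInvolutiveFrames_eigenDist (hS : S.IsWeakFKappaMu κ μ) (hQ : S.LieQVanishes)
    (hN : S.NablaQVanishes) (hc : c ≠ 0) (hcκ : c ^ 2 = 1 - κ) (i : Fin s) :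
    HasInvolutiveFrames n (S.eigenDist i c) := by
  intro x
  obtain ⟨V, hV, hm, hl⟩ := hasFrames_eigenDist hS hQ hc hcκ i x
  exact ⟨V, hV, hm, hl, fun a b =>
    bracket_mem_eigenDist hS hQ hN hc hcκ ⟨hV a, hm a⟩ ⟨hV b, hm b⟩⟩

theorem hasInvolutiveFrames_eigenDist_zero (hS : S.IsWeakAlmostS) (i : Fin s) :
    HasInvolutiveFrames s (S.eigenDist i 0) := fun x =>
  ⟨S.ξ, S.smooth_ξ, fun j y => ξ_mem_eigenDist hS i j y, linearIndependent_ξ x,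
    bracket_mem_eigenDist_zero hS i⟩

end WeakMetricFStructure

end WeakF

end

theorem mainTheorem7 (n s : ℕ) (hn : 0 < n) (hs : 0 < s)
    (M : Type*) [TopologicalSpace M] [T2Space M] [SecondCountableTopology M] [Nonempty M]
    [ChartedSpace (EuclideanSpace ℝ (Fin (2 * n + s))) M]
    [IsManifold 𝓘(ℝ, EuclideanSpace ℝ (Fin (2 * n + s))) ∞ M]
    (S : WeakF.WeakMetricFStructure n s M) (κ μ : ℝ)
    (hS : S.IsWeakFKappaMu κ μ) (hQ : S.LieQVanishes) :
    κ ≤ 1 ∧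
    (∀ i j, S.htilde i = S.htilde j) ∧
    (κ < 1 → ∀ i, ∀ lam : ℝ, lam = Real.sqrt (1 - κ) →
      (WeakF.IsDistribution s (S.eigenDist i 0) ∧
        WeakF.IsDistribution n (S.eigenDist i lam) ∧
        WeakF.IsDistribution n (S.eigenDist i (-lam))) ∧
      (S.Orthogonal (S.eigenDist i 0) (S.eigenDist i lam) ∧
        S.Orthogonal (S.eigenDist i 0) (S.eigenDist i (-lam)) ∧
        S.Orthogonal (S.eigenDist i lam) (S.eigenDist i (-lam))) ∧
      (∀ x, S.eigenDist i 0 x ⊔ S.eigenDist i lam x ⊔ S.eigenDist i (-lam) x = ⊤) ∧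
      (S.NablaQVanishes →
        WeakF.IsIntegrable s (S.eigenDist i 0) ∧
        WeakF.IsIntegrable n (S.eigenDist i lam) ∧
        WeakF.IsIntegrable n (S.eigenDist i (-lam)))) := by
  open WeakF WeakMetricFStructure in
  refine ⟨kappa_le_one hn hs hS hQ, htilde_eq hS hQ, ?_⟩
  rintro hκ i lam rfl
  have h1 : 0 < 1 - κ := sub_pos.2 hκ
  have hp : Real.sqrt (1 - κ) ≠ 0 := (Real.sqrt_pos.2 h1).ne'
  have hp2 : Real.sqrt (1 - κ) ^ 2 = 1 - κ := Real.sq_sqrt h1.le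
  have hm : -Real.sqrt (1 - κ) ≠ 0 := neg_ne_zero.2 hp
  have hm2 : (-Real.sqrt (1 - κ)) ^ 2 = 1 - κ := by rw [neg_sq, hp2]
  have hpm : Real.sqrt (1 - κ) ≠ -Real.sqrt (1 - κ) := fun h => hp (self_eq_neg.1 h)
  open WeakF WeakMetricFStructure in
  exact ⟨⟨(hasFrames_eigenDist_zero hS.1 i).isDistribution S.g (finrank_eigenDist_zero hS hQ hκ i),
      (hasFrames_eigenDist hS hQ hp hp2 i).isDistribution S.g (finrank_eigenDist hS hQ hp hp2 i),
      (hasFrames_eigenDist hS hQ hm hm2 i).isDistribution S.g (finrank_eigenDist hS hQ hm hm2 i)⟩,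
    ⟨orthogonal_eigenDist hS.1 hQ i hp.symm, orthogonal_eigenDist hS.1 hQ i hm.symm,
      orthogonal_eigenDist hS.1 hQ i hpm⟩,
    eigenDist_sup_top hS hQ hp hp2 i,
    fun hN => ⟨(hasInvolutiveFrames_eigenDist_zero hS.1 i).isIntegrable S.g
        (finrank_eigenDist_zero hS hQ hκ i),
      (hasInvolutiveFrames_eigenDist hS hQ hN hp hp2 i).isIntegrable S.g
        (finrank_eigenDist hS hQ hp hp2 i),
      (hasInvolutiveFrames_eigenDist hS hQ hN hm hm2 i).isIntegrable S.g
        (finrank_eigenDist hS hQ hm hm2 i)⟩⟩
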